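/- For an open set $U\subset\mathbb R^2$ let $H^1(U)$ be the space of real functions $\phi\in L^2(U)$ with weak gradient $D\phi\in L^2(U;\mathbb R^2)$, and let $$C_P(U):=\sup\Big\{\|\phi\|_{L^2(U)}:\ \phi\in H^1(U),\ \|D\phi\|_{L^2(U)}=1,\ \int_U\phi=0\Big\}\in[0,\infty]$$ be its Poincaré constant (for the Neumann problem). For $\delta>0$ let $\mathcal F_\delta$ be the class of all domains $$E=B(z_0,r_0)\setminus\bigcup_{i=1}^n\overline{B(z_i,r_i)}\subset\mathbb R^2,$$ with $n\in\{0,1,2,\dots\}$, $z_0,\dots,z_n\in\mathbb R^2$ and $r_0,\dots,r_n>0$, such that $B(z_i,r_i)\subset B(z_0,r_0)$ for every $i\ge1$, the closed disks $\overline{B(z_i,r_i)}$, $1\le i\le n$, are pairwise disjoint, and $$F(E):=\frac1{2r_0}\min\Big\{\min_{0\le i<j\le n}\operatorname{dist}\big(\partial B(z_i,r_i),\partial B(z_j,r_j)\big),\ \min_{1\le i\le n}r_i\Big\}\ge\delta,$$ where a minimum over no indices is $+\infty$. **Theorem.** For every $0<\delta<1$ there is a constant $C(\delta)\in(0,\infty)$,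 depending only on $\delta$, such that $$C_P(E)\le C(\delta)\,r_0$$ for every $E=B(z_0,r_0)\setminus\bigcup_{i=1}^n\overline{B(z_i,r_i)}\in\mathcal F_\delta$. In particular the bound is uniform in the number, the positions and the radii of the holes. -/

import Mathlib

open MeasureTheory
open scoped ENNReal ContDiff

noncomputable section

/-- The Euclidean plane. -/
abbrev Plane : Type := EuclideanSpace ℝ (Fin 2)

/-- `g` is the weak (distributional) gradient of the real function `φ` on the open set `U`:
both are locally integrable on `U`, and `∫_U φ ∂_v ψ = - ∫_U (g · v) ψ` for every direction `v`
and every smooth test function `ψ` with compact support contained in `U`. -/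
def HasWeakGradientOn (U : Set Plane) (φ : Plane → ℝ) (g : Plane → Plane) : Prop :=
  LocallyIntegrableOn φ U volume ∧ LocallyIntegrableOn g U volume ∧
    ∀ ψ : Plane → ℝ, ContDiff ℝ ∞ ψ → HasCompactSupport ψ → tsupport ψ ⊆ U →
      ∀ v : Plane,
        ∫ x in U, φ x * fderiv ℝ ψ x v = - ∫ x in U, inner ℝ (g x) v * ψ x

/-- `φ ∈ H¹(U)` with weak gradient `Dφ = g`: both `φ` and `g` are square integrable on `U`. -/
def MemSobolevH1 (U : Set Plane) (φ : Plane → ℝ) (g : Plane → Plane) : Prop :=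
  MemLp φ 2 (volume.restrict U) ∧ MemLp g 2 (volume.restrict U) ∧ HasWeakGradientOn U φ g

/-- The Neumann Poincaré constant of the open set `U`, an extended nonnegative real:
the supremum of `‖φ‖_{L²(U)}` over all `φ ∈ H¹(U)` with `‖Dφ‖_{L²(U)} = 1` and `∫_U φ = 0`. -/
def poincareConstant (U : Set Plane) : ℝ≥0∞ :=
  sSup {m : ℝ≥0∞ | ∃ (φ : Plane → ℝ) (g : Plane → Plane), MemSobolevH1 U φ g ∧
    eLpNorm g 2 (volume.restrict U) = 1 ∧ ∫ x in U, φ x = 0 ∧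
    m = eLpNorm φ 2 (volume.restrict U)}

/-- The distance between two sets of points of the plane. -/
def setDist (A B : Set Plane) : ℝ≥0∞ := ⨅ x ∈ A, ⨅ y ∈ B, edist x y

/-- A disk `B(z₀, r₀)` together with `n ≥ 0` circular holes `B(z₁, r₁), …, B(zₙ, rₙ)` that are
contained in it and have pairwise disjoint closures. -/
structure PerforatedDisk where
  /-- the number of holes -/
  n : ℕ
  /-- the centres; index `0` is the outer disk -/
  z : Fin (n + 1) → Plane
  /-- the radii; index `0` is the outer disk -/
  r : Fin (n + 1) → ℝ
  r_pos : ∀ i, 0 < r i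
  hole_subset : ∀ i, i ≠ 0 → Metric.ball (z i) (r i) ⊆ Metric.ball (z 0) (r 0)
  holes_disjoint : ∀ i j, i ≠ 0 → j ≠ 0 → i ≠ j →
    Disjoint (Metric.closedBall (z i) (r i)) (Metric.closedBall (z j) (r j))

namespace PerforatedDisk

/-- The open domain `B(z₀, r₀) \ ⋃ᵢ closure B(zᵢ, rᵢ)`. -/
def domain (E : PerforatedDisk) : Set Plane :=
  Metric.ball (E.z 0) (E.r 0) \
    ⋃ (i : Fin (E.n + 1)) (_ : i ≠ 0), Metric.closedBall (E.z i) (E.r i)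

/-- The separation number
`F(E) = (1 / (2 r₀)) min { min_{i ≠ j} dist(∂Bᵢ, ∂Bⱼ), min_i rᵢ }`, where `i, j` range over
`0, …, n` in the first minimum (so that the distances of the holes to the outer circle count)
and `i` ranges over `1, …, n` in the second one. A minimum over no indices is `∞`. -/
def separation (E : PerforatedDisk) : ℝ≥0∞ :=
  min (⨅ (i : Fin (E.n + 1)) (j : Fin (E.n + 1)) (_ : i ≠ j),
        setDist (Metric.sphere (E.z i) (E.r i)) (Metric.sphere (E.z j) (E.r j)))
      (⨅ (i : Fin (E.n + 1)) (_ : i ≠ 0), ENNReal.ofReal (E.r i)) /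
    ENNReal.ofReal (2 * E.r 0)

/-- The class `𝓕_δ` of the perforated disks `E` with `F(E) ≥ δ`. -/
def family (δ : ℝ) : Set PerforatedDisk := {E | ENNReal.ofReal δ ≤ E.separation}

end PerforatedDisk

end

/-! Separation gives every hole a collar of width comparable to `δ * r₀`; the collars are pairwise
disjoint, lie in the domain, and are no wider than the radius of their hole. On collar `i` the
function is close in L² to a constant `m i`, with a constant that depends only on the scale
(`exists_poincare_annulus`). Interpolating across the collar between `f` and `m i` extends `f` into
the hole with controlled energy, and the Poincaré inequality of the full disk applies to the
extension. Since the collars are disjoint, their energies sum to at most the energy of the domain,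
so neither the number nor the position of the holes enters (`exists_poincare_perforated`).

Both model inequalities come from `Convex.exists_poincare`: directly for the disk, through polar
coordinates for the annulus. All this is done for functions that are C¹ on the whole plane, whose
values inside the holes never matter. For `φ` in H¹, mollification at scale `ε` gives C¹ functions
whose energy on the domain shrunk by `ε` is at most that of `φ`; the shrunk domains keep collars of
a fixed width, and Fatou's lemma yields the limit (`exists_poincare_of_memSobolevH1`). -/

noncomputable section

/-! ### Poincaré inequality on convex sets -/

section Convex

variable {V : Type*} [NormedAddCommGroup V] [NormedSpace ℝ V]

/-- The square of the integral over a probability measure is at most the integral of the square. -/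
theorem sq_lintegral_le_lintegral_sq {α : Type*} [MeasurableSpace α] (μ : Measure α)
    [IsProbabilityMeasure μ] {f : α → ℝ≥0∞} (hf : AEMeasurable f μ) :
    (∫⁻ a, f a ∂μ) ^ 2 ≤ ∫⁻ a, f a ^ 2 ∂μ := by
  have h := ENNReal.lintegral_mul_le_Lp_mul_Lq μ (p := 2) (q := 2)
    (by constructor <;> norm_num) hf (aemeasurable_const (b := (1 : ℝ≥0∞)))
  simp only [Pi.mul_apply, mul_one, ENNReal.one_rpow, lintegral_const, measure_univ] at h
  calc (∫⁻ a, f a ∂μ) ^ 2 ≤ ((∫⁻ a, f a ^ (2 : ℝ) ∂μ) ^ (1 / 2 : ℝ)) ^ 2 := by gcongr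
    _ = ∫⁻ a, f a ^ 2 ∂μ := by
      rw [← ENNReal.rpow_natCast, ← ENNReal.rpow_mul]
      norm_num

theorem enorm_sub_le_lintegral_segment {f : V → ℝ} (hf : ContDiff ℝ 1 f) (x y : V) :
    ‖f y - f x‖ₑ ≤ ∫⁻ t in Set.Ioc (0 : ℝ) 1, ‖fderiv ℝ f (x + t • (y - x)) (y - x)‖ₑ := by
  have hd : ∀ t : ℝ, HasDerivAt (fun t : ℝ => f (x + t • (y - x)))
      (fderiv ℝ f (x + t • (y - x)) (y - x)) t := by
    intro t
    have h1 : HasDerivAt (fun t : ℝ => x + t • (y - x)) (y - x) t := by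
      simpa using ((hasDerivAt_id t).smul_const (y - x)).const_add x
    exact ((hf.differentiable one_ne_zero) _).hasFDerivAt.comp_hasDerivAt t h1
  have hc : Continuous fun t : ℝ => fderiv ℝ f (x + t • (y - x)) (y - x) :=
    ((hf.continuous_fderiv one_ne_zero).comp (by fun_prop)).clm_apply continuous_const
  have := intervalIntegral.integral_eq_sub_of_hasDerivAt (a := 0) (b := 1)
    (fun t _ => hd t) (hc.intervalIntegrable _ _)
  simp only [one_smul, add_sub_cancel, zero_smul, add_zero] at this
  rw [← this, intervalIntegral.integral_of_le zero_le_one]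
  exact enorm_integral_le_lintegral_enorm _

variable [FiniteDimensional ℝ V] [MeasurableSpace V] [BorelSpace V]
  (μ : Measure V) [μ.IsAddHaarMeasure]

theorem lintegral_comp_add_smul (g : V → ℝ≥0∞) (a : V) {t : ℝ} (ht : 0 < t) :
    ∫⁻ y, g (a + t • y) ∂μ = ENNReal.ofReal ((t ^ Module.finrank ℝ V)⁻¹) * ∫⁻ y, g y ∂μ := by
  have h1 : ∫⁻ y, g (a + t • y) ∂μ = ∫⁻ y, g (a + y) ∂(Measure.map (t • ·) μ) :=
    ((Homeomorph.smulOfNeZero t ht.ne').toMeasurableEquiv.measurableEmbedding.lintegral_map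
      (fun y => g (a + y))).symm
  rw [h1, Measure.map_addHaar_smul μ ht.ne', lintegral_smul_measure, lintegral_add_left_eq_self,
    abs_of_pos (by positivity), smul_eq_mul]

/-- The homothety of centre `x` and ratio `t` maps `K` into itself by convexity, and its inverse has
Jacobian `t⁻ᵈ`, at most `2ᵈ` when `t ≥ 1/2`. -/
theorem setLIntegral_comp_lineMap_le {K : Set V} (hK : Convex ℝ K) (hKm : MeasurableSet K)
    (g : V → ℝ≥0∞) {x : V} (hx : x ∈ K) {t : ℝ} (ht : 1 / 2 ≤ t) (ht' : t ≤ 1) :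
    ∫⁻ y in K, g (x + t • (y - x)) ∂μ ≤ 2 ^ Module.finrank ℝ V * ∫⁻ y in K, g y ∂μ := by
  have ht0 : 0 < t := by linarith
  calc ∫⁻ y in K, g (x + t • (y - x)) ∂μ
      = ∫⁻ y, K.indicator (fun y => g (x + t • (y - x))) y ∂μ := (lintegral_indicator hKm _).symm
    _ ≤ ∫⁻ y, K.indicator g ((x - t • x) + t • y) ∂μ := by
        refine lintegral_mono fun y => ?_
        by_cases hy : y ∈ K
        · have e : x + t • (y - x) = (x - t • x) + t • y := by rw [smul_sub]; abel
          have hm : (x - t • x) + t • y ∈ K := by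
            rw [← e]
            exact hK.add_smul_sub_mem hx hy ⟨ht0.le, ht'⟩
          simp only [Set.indicator_of_mem hy, Set.indicator_of_mem hm, e, le_refl]
        · simp [Set.indicator_of_notMem hy]
    _ = ENNReal.ofReal ((t ^ Module.finrank ℝ V)⁻¹) * ∫⁻ y in K, g y ∂μ := by
        rw [lintegral_comp_add_smul μ _ _ ht0, lintegral_indicator hKm]
    _ ≤ _ := by
        gcongr
        rw [← inv_pow, ENNReal.ofReal_pow (by positivity)]
        gcongr
        rw [← ENNReal.ofReal_ofNat]
        apply ENNReal.ofReal_le_ofReal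
        rw [inv_le_comm₀ ht0 (by norm_num)]
        linarith

/-- A value of the function does at least as well as the average. -/
theorem exists_setLIntegral_le_of_double_le {α : Type*} [MeasurableSpace α] {μ : Measure α}
    {K : Set α} (h0 : μ K ≠ 0) (h1 : μ K ≠ ⊤) {F : α → α → ℝ≥0∞} {I : ℝ≥0∞}
    (hF : AEMeasurable (fun x => ∫⁻ y in K, F x y ∂μ) (μ.restrict K))
    (h : ∫⁻ x in K, ∫⁻ y in K, F x y ∂μ ∂μ ≤ μ K * I) :
    ∃ x, ∫⁻ y in K, F x y ∂μ ≤ I := by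
  have : IsFiniteMeasure (μ.restrict K) := ⟨by simpa using h1.lt_top⟩
  obtain ⟨x, hx⟩ := exists_le_laverage (μ := μ.restrict K)
    (by simpa [Measure.restrict_eq_zero] using h0) hF
  refine ⟨x, hx.trans ?_⟩
  rw [laverage_eq, Measure.restrict_apply_univ]
  exact ENNReal.div_le_of_le_mul' h

/-- **Poincaré inequality on a convex set**, for a function of class `C¹` whose derivative in the
directions of `K - K` is controlled by `G`. -/
theorem Convex.exists_poincare {K : Set V} (hK : Convex ℝ K) (hKm : MeasurableSet K)
    (h0 : μ K ≠ 0) (h1 : μ K ≠ ⊤) {f : V → ℝ} (hf : ContDiff ℝ 1 f) {G : V → ℝ≥0∞}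
    (hG : Measurable G)
    (hfG : ∀ x ∈ K, ∀ y ∈ K, ∀ z ∈ K, ‖fderiv ℝ f x (y - z)‖ₑ ≤ G x) :
    ∃ c : ℝ, ∫⁻ x in K, ‖f x - c‖ₑ ^ 2 ∂μ ≤
      2 ^ Module.finrank ℝ V * ∫⁻ x in K, G x ^ 2 ∂μ := by
  have hfin : IsFiniteMeasure (μ.restrict K) := ⟨by simpa using h1.lt_top⟩
  -- Bounding the double integral of the differences suffices: some `x` does no worse than the
  -- average, and `c = f x`.
  set S := 2 ^ Module.finrank ℝ V * ∫⁻ x in K, G x ^ 2 ∂μ with hS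
  suffices h : ∫⁻ x in K, ∫⁻ y in K, ‖f y - f x‖ₑ ^ 2 ∂μ ∂μ ≤ μ K * S by
    obtain ⟨x, hx⟩ := exists_setLIntegral_le_of_double_le h0 h1
      (Measurable.aemeasurable <| Measurable.lintegral_prod_right' (f := fun p : V × V =>
        ‖f p.2 - f p.1‖ₑ ^ 2) (by
          have := hf.continuous
          exact (Continuous.measurable (by fun_prop)))) h
    exact ⟨f x, hx⟩
  have hmG : Measurable fun q : ℝ × V × V => G (q.2.1 + q.1 • (q.2.2 - q.2.1)) ^ 2 :=
    (hG.comp (Continuous.measurable (by fun_prop))).pow_const 2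
  have hprob : IsProbabilityMeasure ((volume : Measure ℝ).restrict (Set.Ioc (0 : ℝ) 1)) :=
    ⟨by simp⟩
  have hpt : ∀ x ∈ K, ∀ y ∈ K, ‖f y - f x‖ₑ ^ 2 ≤
      ∫⁻ t in Set.Ioc (0 : ℝ) 1, G (x + t • (y - x)) ^ 2 := by
    intro x hx y hy
    calc ‖f y - f x‖ₑ ^ 2 ≤ (∫⁻ t in Set.Ioc (0 : ℝ) 1, G (x + t • (y - x))) ^ 2 := by
          gcongr
          refine (enorm_sub_le_lintegral_segment hf x y).trans ?_
          refine setLIntegral_mono' measurableSet_Ioc fun t ht => ?_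
          exact hfG _ (hK.add_smul_sub_mem hx hy ⟨ht.1.le, ht.2⟩) y hy x hx
      _ ≤ _ := sq_lintegral_le_lintegral_sq _
          (hG.comp (Continuous.measurable (by fun_prop))).aemeasurable
  have hslice : ∀ t ∈ Set.Ioc (0 : ℝ) 1,
      ∫⁻ x in K, ∫⁻ y in K, G (x + t • (y - x)) ^ 2 ∂μ ∂μ ≤ μ K * S := by
    intro t ht
    -- The point at time `t` is at ratio `t` from `x` and at ratio `1 - t` from `y`. One ratio is at
    -- least `1/2`; that endpoint is frozen and the other variable is integrated.
    rcases le_total (1 / 2) t with h | h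
    · calc _ ≤ ∫⁻ x in K, S ∂μ := setLIntegral_mono' hKm fun x hx =>
            setLIntegral_comp_lineMap_le μ hK hKm (fun x => G x ^ 2) hx h ht.2
        _ = μ K * S := by rw [setLIntegral_const, mul_comm]
    · rw [lintegral_lintegral_swap]
      · calc _ ≤ ∫⁻ x in K, S ∂μ := setLIntegral_mono' hKm fun x hx => by
              refine le_of_eq_of_le ?_ (setLIntegral_comp_lineMap_le μ hK hKm (fun x => G x ^ 2) hx
                (t := 1 - t) (by linarith) (by linarith [ht.1]))
              congr 1
              ext y
              congr 2
              module
          _ = μ K * S := by rw [setLIntegral_const, mul_comm]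
      · exact (hmG.comp (measurable_const.prodMk measurable_id)).aemeasurable
  calc ∫⁻ x in K, ∫⁻ y in K, ‖f y - f x‖ₑ ^ 2 ∂μ ∂μ
      ≤ ∫⁻ x in K, ∫⁻ y in K, ∫⁻ t in Set.Ioc (0 : ℝ) 1, G (x + t • (y - x)) ^ 2 ∂volume ∂μ ∂μ :=
        setLIntegral_mono' hKm fun x hx => setLIntegral_mono' hKm fun y hy => hpt x hx y hy
    _ = ∫⁻ x in K, ∫⁻ t in Set.Ioc (0 : ℝ) 1, ∫⁻ y in K, G (x + t • (y - x)) ^ 2 ∂μ ∂volume ∂μ := by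
        congr 1
        ext x
        apply lintegral_lintegral_swap
        exact (hmG.comp (measurable_snd.prodMk
          (measurable_const.prodMk measurable_fst))).aemeasurable
    _ = ∫⁻ t in Set.Ioc (0 : ℝ) 1, ∫⁻ x in K, ∫⁻ y in K, G (x + t • (y - x)) ^ 2 ∂μ ∂μ ∂volume := by
        apply lintegral_lintegral_swap
        apply Measurable.aemeasurable
        apply Measurable.lintegral_prod_right' (f := fun q : (V × ℝ) × V =>
          G (q.1.1 + q.1.2 • (q.2 - q.1.1)) ^ 2)
        exact hmG.comp ((measurable_snd.comp measurable_fst).prodMk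
          ((measurable_fst.comp measurable_fst).prodMk measurable_snd))
    _ ≤ ∫⁻ t in Set.Ioc (0 : ℝ) 1, μ K * S := setLIntegral_mono' measurableSet_Ioc hslice
    _ = μ K * S := by simp

end Convex


/-! ### Polar coordinates and the Poincaré inequality on an annulus -/

section Annulus

/-- Polar coordinates around `z`. -/
def polarMap (z : Plane) (p : ℝ × ℝ) : Plane :=
  z + !₂[p.1 * Real.cos p.2, p.1 * Real.sin p.2]

/-- The open annulus `r < |x - z| < R`. -/
def annulus (z : Plane) (r R : ℝ) : Set Plane := {x | r < dist x z ∧ dist x z < R}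

theorem isOpen_annulus (z : Plane) (r R : ℝ) : IsOpen (annulus z r R) :=
  (isOpen_lt continuous_const (continuous_id.dist continuous_const)).inter
    (isOpen_lt (continuous_id.dist continuous_const) continuous_const)

theorem contDiff_polarMap (z : Plane) : ContDiff ℝ 1 (polarMap z) := by
  unfold polarMap
  refine contDiff_const.add ?_
  rw [contDiff_euclidean]
  intro i
  fin_cases i
  · simp only [Fin.zero_eta, Matrix.cons_val_zero]; fun_prop
  · simp only [Fin.mk_one, Matrix.cons_val_one, Matrix.cons_val_fin_one]; fun_prop

theorem dist_polarMap (z : Plane) (p : ℝ × ℝ) : dist (polarMap z p) z = |p.1| := by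
  rw [polarMap, dist_self_add_left, EuclideanSpace.norm_eq]
  simp only [Fin.sum_univ_two, Matrix.cons_val_zero, Matrix.cons_val_one,
    Matrix.cons_val_fin_one, Real.norm_eq_abs, sq_abs]
  rw [mul_pow, mul_pow, ← mul_add, Real.cos_sq_add_sin_sq, mul_one, Real.sqrt_sq_eq_abs]

theorem hasDerivAt_polarMap_line (z : Plane) (p v : ℝ × ℝ) :
    HasDerivAt (fun t : ℝ => polarMap z (p + t • v))
      !₂[v.1 * Real.cos p.2 - p.1 * Real.sin p.2 * v.2,
        v.1 * Real.sin p.2 + p.1 * Real.cos p.2 * v.2] 0 := by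
  unfold polarMap
  refine HasDerivAt.const_add z ?_
  have h1 : HasDerivAt (fun t : ℝ => p.1 + t * v.1) v.1 0 := by
    simpa using ((hasDerivAt_id (0 : ℝ)).mul_const v.1).const_add p.1
  have h2 : HasDerivAt (fun t : ℝ => p.2 + t * v.2) v.2 0 := by
    simpa using ((hasDerivAt_id (0 : ℝ)).mul_const v.2).const_add p.2
  rw [hasDerivAt_iff_hasFDerivAt, ← hasFDerivWithinAt_univ, hasFDerivWithinAt_euclidean]
  intro i
  fin_cases i
  · convert! (h1.mul h2.cos).hasFDerivAt.hasFDerivWithinAt using 1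
    ext
    simp
    ring
  · convert! (h1.mul h2.sin).hasFDerivAt.hasFDerivWithinAt using 1
    ext
    simp
    ring

/-- The radial and angular directions are orthogonal, so the squared norm is exactly `v.1 ^ 2 + (p.1
* v.2) ^ 2`. -/
theorem norm_fderiv_polarMap_le (z : Plane) (p v : ℝ × ℝ) :
    ‖fderiv ℝ (polarMap z) p v‖ ≤ |v.1| + |p.1| * |v.2| := by
  have h1 : HasDerivAt (fun t : ℝ => p + t • v) v 0 := by
    simpa using ((hasDerivAt_id (0 : ℝ)).smul_const v).const_add p
  have h2 : HasDerivAt (fun t : ℝ => polarMap z (p + t • v)) (fderiv ℝ (polarMap z) p v) 0 := by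
    have := (((contDiff_polarMap z).differentiable one_ne_zero) (p + (0 : ℝ) • v)).hasFDerivAt
    have h3 := this.comp_hasDerivAt (0 : ℝ) h1
    rw [zero_smul, add_zero] at h3
    exact h3
  rw [h2.unique (hasDerivAt_polarMap_line z p v), EuclideanSpace.norm_eq]
  simp only [Fin.sum_univ_two, Matrix.cons_val_zero, Matrix.cons_val_one,
    Matrix.cons_val_fin_one, Real.norm_eq_abs, sq_abs]
  rw [Real.sqrt_le_left (by positivity)]
  have e : (v.1 * Real.cos p.2 - p.1 * Real.sin p.2 * v.2) ^ 2 +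
      (v.1 * Real.sin p.2 + p.1 * Real.cos p.2 * v.2) ^ 2 = v.1 ^ 2 + (p.1 * v.2) ^ 2 := by
    linear_combination (v.1 ^ 2 + (p.1 * v.2) ^ 2) * Real.sin_sq_add_cos_sq p.2
  rw [e, ← abs_mul, ← sq_abs v.1, ← sq_abs (p.1 * v.2)]
  nlinarith [abs_nonneg v.1, abs_nonneg (p.1 * v.2)]

theorem lintegral_comp_polarMap (z : Plane) (f : Plane → ℝ≥0∞) :
    ∫⁻ p in Set.Ioi (0 : ℝ) ×ˢ Set.Ioo (-Real.pi) Real.pi,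
      ENNReal.ofReal p.1 * f (polarMap z p) = ∫⁻ x, f x := by
  have hmp : MeasurePreserving (fun p : ℝ × ℝ => (!₂[p.1, p.2] : Plane)) := by
    have := (PiLp.volume_preserving_toLp (Fin 2)).comp
      (volume_preserving_finTwoArrow ℝ).symm
    convert! this using 1
  have hemb : MeasurableEmbedding (fun p : ℝ × ℝ => (!₂[p.1, p.2] : Plane)) := by
    have := (MeasurableEquiv.toLp 2 (Fin 2 → ℝ)).measurableEmbedding.comp
      (MeasurableEquiv.finTwoArrow (α := ℝ)).symm.measurableEmbedding
    convert! this using 1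
  calc _ = ∫⁻ p : ℝ × ℝ, f (z + !₂[p.1, p.2]) := by
        rw [← lintegral_comp_polarCoord_symm]
        rfl
    _ = ∫⁻ x, f (z + x) := hmp.lintegral_comp_emb hemb (fun x => f (z + x))
    _ = _ := lintegral_add_left_eq_self _ _

theorem setLIntegral_annulus (z : Plane) {r R : ℝ} (hr : 0 ≤ r) (f : Plane → ℝ≥0∞) :
    ∫⁻ x in annulus z r R, f x =
      ∫⁻ p in Set.Ioo r R ×ˢ Set.Ioo (-Real.pi) Real.pi,
        ENNReal.ofReal p.1 * f (polarMap z p) := by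
  have hm : MeasurableSet (Set.Ioo r R ×ˢ Set.Ioo (-Real.pi) Real.pi) :=
    measurableSet_Ioo.prod measurableSet_Ioo
  have hs : Set.Ioo r R ×ˢ Set.Ioo (-Real.pi) Real.pi ⊆
      Set.Ioi (0 : ℝ) ×ˢ Set.Ioo (-Real.pi) Real.pi :=
    Set.prod_mono (fun x hx => hr.trans_lt hx.1) le_rfl
  rw [← lintegral_indicator (isOpen_annulus z r R).measurableSet, ← lintegral_comp_polarMap z,
    ← Set.inter_eq_left.2 hs, ← setLIntegral_indicator hm]
  refine setLIntegral_congr_fun (measurableSet_Ioi.prod measurableSet_Ioo) fun p hp => ?_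
  have hp1 : 0 < p.1 := hp.1
  have : polarMap z p ∈ annulus z r R ↔ p ∈ Set.Ioo r R ×ˢ Set.Ioo (-Real.pi) Real.pi := by
    simp only [annulus, Set.mem_ofPred_eq, dist_polarMap, abs_of_pos hp1, Set.mem_prod, Set.mem_Ioo]
    exact ⟨fun h => ⟨h, hp.2⟩, fun h => h.1⟩
  by_cases h : polarMap z p ∈ annulus z r R
  · simp only [Set.indicator_of_mem h, Set.indicator_of_mem (this.1 h)]
  · simp only [Set.indicator_of_notMem h, Set.indicator_of_notMem (fun h' => h (this.2 h')),
      mul_zero]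

/-- **Poincaré inequality on an annulus**. -/
theorem exists_poincare_annulus (z : Plane) {r R : ℝ} (hr : 0 < r) (hrR : r < R) (hR : R ≤ 2 * r)
    {f : Plane → ℝ} (hf : ContDiff ℝ 1 f) :
    ∃ c : ℝ, ∫⁻ x in annulus z r R, ‖f x - c‖ₑ ^ 2 ≤
      ENNReal.ofReal (512 * R ^ 2) * ∫⁻ x in annulus z r R, ‖fderiv ℝ f x‖ₑ ^ 2 := by
  have hR0 : 0 < R := hr.trans hrR
  -- The annulus cut along a ray is the image of a convex rectangle. The ray is null, and no
  -- periodicity in the angle is needed.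
  set Q := Set.Ioo r R ×ˢ Set.Ioo (-Real.pi) Real.pi with hQ
  have hQm : MeasurableSet Q := measurableSet_Ioo.prod measurableSet_Ioo
  have hfc : Continuous (fderiv ℝ f) := hf.continuous_fderiv one_ne_zero
  have hpc : Continuous (polarMap z) := (contDiff_polarMap z).continuous
  have hvol : (volume : Measure (ℝ × ℝ)) Q =
      ENNReal.ofReal (R - r) * ENNReal.ofReal (Real.pi - -Real.pi) := by
    rw [hQ, Measure.volume_eq_prod, Measure.prod_prod, Real.volume_Ioo, Real.volume_Ioo]
  obtain ⟨c, hc⟩ := ((convex_Ioo r R).prod (convex_Ioo (-Real.pi) Real.pi)).exists_poincare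
    (volume : Measure (ℝ × ℝ)) hQm
    (by
      rw [← hQ, hvol]
      have := Real.pi_pos
      simp only [ne_eq, mul_eq_zero, ENNReal.ofReal_eq_zero, not_or, not_le]
      constructor <;> linarith)
    (by rw [← hQ, hvol]; exact ENNReal.mul_ne_top ENNReal.ofReal_ne_top ENNReal.ofReal_ne_top)
    (hf.comp (contDiff_polarMap z))
    -- `8 * R = R + R * 7`: two radii in `Q` differ by at most `R`, two angles by at most `7`, as
    -- `2π < 7`.
    (G := fun p => ENNReal.ofReal (8 * R) * ‖fderiv ℝ f (polarMap z p)‖ₑ)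
    (by
      apply Measurable.const_mul
      exact (Continuous.measurable (by fun_prop)))
    (by
      intro p hp q hq s hs
      have hd : fderiv ℝ (f ∘ polarMap z) p =
          (fderiv ℝ f (polarMap z p)).comp (fderiv ℝ (polarMap z) p) :=
        fderiv_comp p ((hf.differentiable one_ne_zero) _)
          (((contDiff_polarMap z).differentiable one_ne_zero) _)
      have h1 : ‖fderiv ℝ (polarMap z) p (q - s)‖ ≤ 8 * R := by
        refine (norm_fderiv_polarMap_le z p (q - s)).trans ?_
        have e1 : |(q - s).1| ≤ R := by
          rw [Prod.fst_sub, abs_le]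
          constructor <;> linarith [hq.1.1, hq.1.2, hs.1.1, hs.1.2]
        have e2 : |(q - s).2| ≤ 7 := by
          rw [Prod.snd_sub, abs_le]
          constructor <;> linarith [hq.2.1, hq.2.2, hs.2.1, hs.2.2, Real.pi_lt_d2]
        have e3 : |p.1| ≤ R := by
          rw [abs_le]
          constructor <;> linarith [hp.1.1, hp.1.2]
        nlinarith [abs_nonneg p.1, abs_nonneg (q - s).2]
      rw [hd, ContinuousLinearMap.comp_apply, mul_comm, ← enorm_norm (fderiv ℝ f _),
        ← ofReal_norm, ← ofReal_norm, norm_norm, ← ENNReal.ofReal_mul (norm_nonneg _)]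
      exact ENNReal.ofReal_le_ofReal (((fderiv ℝ f _).le_opNorm _).trans (by gcongr)))
  refine ⟨c, ?_⟩
  rw [setLIntegral_annulus z hr.le, setLIntegral_annulus z hr.le]
  calc ∫⁻ p in Q, ENNReal.ofReal p.1 * ‖f (polarMap z p) - c‖ₑ ^ 2
      ≤ ∫⁻ p in Q, ENNReal.ofReal R * ‖f (polarMap z p) - c‖ₑ ^ 2 :=
        setLIntegral_mono' hQm fun p hp => by
          gcongr
          exact hp.1.2.le
    _ = ENNReal.ofReal R * ∫⁻ p in Q, ‖f (polarMap z p) - c‖ₑ ^ 2 :=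
        lintegral_const_mul' _ _ ENNReal.ofReal_ne_top
    _ ≤ ENNReal.ofReal R * (2 ^ Module.finrank ℝ (ℝ × ℝ) * ∫⁻ p in Q,
          (ENNReal.ofReal (8 * R) * ‖fderiv ℝ f (polarMap z p)‖ₑ) ^ 2) := by
        gcongr
        exact hc
    -- The Jacobian `p.1` is at least `r` on `Q`, so it is restored at the cost of `1 / r`. The
    -- resulting `256 * R ^ 3 / r` is at most `512 * R ^ 2` because `R ≤ 2 * r`.
    _ ≤ ENNReal.ofReal R * (2 ^ Module.finrank ℝ (ℝ × ℝ) * ∫⁻ p in Q,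
          ENNReal.ofReal (64 * R ^ 2 / r) *
            (ENNReal.ofReal p.1 * ‖fderiv ℝ f (polarMap z p)‖ₑ ^ 2)) := by
        gcongr ENNReal.ofReal R * (2 ^ Module.finrank ℝ (ℝ × ℝ) * ?_)
        refine setLIntegral_mono' hQm fun p hp => ?_
        rw [mul_pow, ← mul_assoc, ← ENNReal.ofReal_pow (by positivity),
          ← ENNReal.ofReal_mul (by positivity)]
        gcongr
        have : r ≤ p.1 := hp.1.1.le
        rw [div_mul_eq_mul_div, le_div_iff₀ hr]
        nlinarith [sq_nonneg R]
    _ = ENNReal.ofReal (R * (4 * (64 * R ^ 2 / r))) *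
          ∫⁻ p in Q, ENNReal.ofReal p.1 * ‖fderiv ℝ f (polarMap z p)‖ₑ ^ 2 := by
        rw [lintegral_const_mul' _ _ ENNReal.ofReal_ne_top, ENNReal.ofReal_mul hR0.le,
          ENNReal.ofReal_mul (p := 4) (by norm_num)]
        have : (2 : ℝ≥0∞) ^ Module.finrank ℝ (ℝ × ℝ) = ENNReal.ofReal 4 := by
          simp only [Module.finrank_prod, Module.finrank_self, ENNReal.ofReal_ofNat]
          norm_num
        rw [this]
        ring
    _ ≤ _ := by
        refine mul_le_mul_left (ENNReal.ofReal_le_ofReal ?_) _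
        rw [← mul_div_assoc, ← mul_div_assoc, div_le_iff₀ hr]
        nlinarith [mul_le_mul_of_nonneg_left hR (sq_nonneg R)]

end Annulus


/-! ### Radial cutoffs with gradient of order `1 / w` -/

section Cutoff

theorem enorm_add_sq_le {V : Type*} [SeminormedAddCommGroup V] (a b : V) :
    ‖a + b‖ₑ ^ 2 ≤ 2 * ‖a‖ₑ ^ 2 + 2 * ‖b‖ₑ ^ 2 := by
  have h2 : (2 : ℝ≥0∞) = ENNReal.ofReal 2 := by simp
  rw [← ofReal_norm, ← ofReal_norm, ← ofReal_norm, h2, ← ENNReal.ofReal_pow (norm_nonneg _),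
    ← ENNReal.ofReal_pow (norm_nonneg _), ← ENNReal.ofReal_pow (norm_nonneg _),
    ← ENNReal.ofReal_mul (by norm_num), ← ENNReal.ofReal_mul (by norm_num),
    ← ENNReal.ofReal_add (by positivity) (by positivity)]
  apply ENNReal.ofReal_le_ofReal
  nlinarith [norm_add_le a b, norm_nonneg (a + b), sq_nonneg (‖a‖ - ‖b‖)]

/-- A radial cutoff: `1` for `|x - z| ≤ r` and `0` for `|x - z| ≥ r + w`. -/
def radialCutoff (z : Plane) (r w : ℝ) (x : Plane) : ℝ :=
  -- Squared distances keep the function smooth at the centre.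
  Real.smoothTransition (((r + w) ^ 2 - ‖x - z‖ ^ 2) / ((r + w) ^ 2 - r ^ 2))

variable {z : Plane} {r w : ℝ} {x : Plane}

theorem contDiff_radialCutoff (z : Plane) (r w : ℝ) : ContDiff ℝ 1 (radialCutoff z r w) :=
  Real.smoothTransition.contDiff.comp
    ((contDiff_const.sub ((contDiff_id.sub contDiff_const).norm_sq ℝ)).div_const _)

theorem radialCutoff_nonneg : 0 ≤ radialCutoff z r w x := Real.smoothTransition.nonneg _

theorem radialCutoff_le_one : radialCutoff z r w x ≤ 1 := Real.smoothTransition.le_one _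

theorem radialCutoff_eq_one (hr : 0 < r) (hw : 0 < w) (hx : dist x z ≤ r) :
    radialCutoff z r w x = 1 := by
  apply Real.smoothTransition.one_of_one_le
  rw [dist_eq_norm] at hx
  rw [one_le_div (by nlinarith)]
  nlinarith [norm_nonneg (x - z)]

theorem radialCutoff_eq_zero (hr : 0 < r) (hw : 0 < w) (hx : r + w ≤ dist x z) :
    radialCutoff z r w x = 0 := by
  apply Real.smoothTransition.zero_of_nonpos
  rw [dist_eq_norm] at hx
  apply div_nonpos_of_nonpos_of_nonneg <;> nlinarith [norm_nonneg (x - z)]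

/-- Off the open annulus the cutoff attains its maximum `1` or its minimum `0`. This covers the two
boundary circles too, where it is not locally constant. -/
theorem fderiv_radialCutoff_eq_zero (hr : 0 < r) (hw : 0 < w) (hx : x ∉ annulus z r (r + w)) :
    fderiv ℝ (radialCutoff z r w) x = 0 := by
  rcases le_or_gt (dist x z) r with h | h
  · refine IsLocalMax.fderiv_eq_zero (.of_forall fun y => ?_)
    rw [radialCutoff_eq_one hr hw h]
    exact radialCutoff_le_one
  · refine IsLocalMin.fderiv_eq_zero (.of_forall fun y => ?_)
    rw [radialCutoff_eq_zero hr hw (not_lt.1 fun h' => hx ⟨h, h'⟩)]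
    exact radialCutoff_nonneg

/-- On the annulus the inner argument has gradient of norm `2|x - z| / (w(2r + w)) ≤ 2 / w`, since
`|x - z| < r + w`. Its values lie in `[0, 1]`, where the derivative of the transition function is
bounded. -/
theorem exists_norm_fderiv_radialCutoff_le :
    ∃ M : ℝ, 0 ≤ M ∧ ∀ (z : Plane) (r w : ℝ) (x : Plane), 0 < r → 0 < w →
      ‖fderiv ℝ (radialCutoff z r w) x‖ ≤ M / w := by
  have hc : Continuous (deriv Real.smoothTransition) :=
    (Real.smoothTransition.contDiff (n := 1)).continuous_deriv le_rfl
  obtain ⟨M, hM⟩ := isCompact_Icc.exists_bound_of_continuousOn (s := Set.Icc (0 : ℝ) 1)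
    hc.continuousOn
  have hM0 : 0 ≤ M := (norm_nonneg _).trans (hM 0 ⟨le_rfl, zero_le_one⟩)
  refine ⟨2 * M, by positivity, fun z r w x hr hw => ?_⟩
  by_cases hx : x ∈ annulus z r (r + w)
  · obtain ⟨h1, h2⟩ := hx
    rw [dist_eq_norm] at h1 h2
    have hD : 0 < (r + w) ^ 2 - r ^ 2 := by nlinarith
    set q : Plane → ℝ := fun x => ((r + w) ^ 2 - ‖x - z‖ ^ 2) / ((r + w) ^ 2 - r ^ 2) with hq
    have hq1 : HasFDerivAt q (((r + w) ^ 2 - r ^ 2)⁻¹ • -((2 : ℝ) • innerSL ℝ (x - z))) x := by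
      have h := (((hasFDerivAt_id x).sub_const z).norm_sq).const_sub ((r + w) ^ 2)
      have := h.const_mul ((r + w) ^ 2 - r ^ 2)⁻¹
      simp only [hq, div_eq_inv_mul]
      convert! this using 1
      rw [two_smul ℝ, two_nsmul]
      rfl
    have hcomp : HasFDerivAt (radialCutoff z r w)
        (deriv Real.smoothTransition (q x) • (((r + w) ^ 2 - r ^ 2)⁻¹ • -((2 : ℝ) • innerSL ℝ (x - z)))) x :=
      (((Real.smoothTransition.contDiff (n := 1)).differentiable one_ne_zero)
        (q x)).hasDerivAt.comp_hasFDerivAt x hq1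
    have hqx : q x ∈ Set.Icc (0 : ℝ) 1 := by
      simp only [hq]
      refine ⟨div_nonneg ?_ hD.le, (div_le_one hD).2 ?_⟩ <;> nlinarith [norm_nonneg (x - z)]
    rw [hcomp.fderiv, norm_smul, norm_smul, norm_neg, norm_smul,
      innerSL_apply_norm, norm_inv, Real.norm_of_nonneg hD.le, Real.norm_two, mul_div_assoc]
    have key : ((r + w) ^ 2 - r ^ 2)⁻¹ * (2 * ‖x - z‖) ≤ 2 / w := by
      rw [inv_mul_le_iff₀ hD, mul_div_assoc', le_div_iff₀ hw]
      nlinarith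
    calc _ ≤ M * (2 / w) := mul_le_mul (hM _ hqx) key (by positivity) hM0
      _ = _ := by ring
  · rw [fderiv_radialCutoff_eq_zero hr hw hx, norm_zero]
    positivity

end Cutoff

/-! ### Poincaré inequality on a disk -/

section Perforated

theorem exists_poincare_ball (z : Plane) {r : ℝ} (hr : 0 < r) {f : Plane → ℝ}
    (hf : ContDiff ℝ 1 f) :
    ∃ c : ℝ, ∫⁻ x in Metric.ball z r, ‖f x - c‖ₑ ^ 2 ≤
      ENNReal.ofReal (16 * r ^ 2) * ∫⁻ x in Metric.ball z r, ‖fderiv ℝ f x‖ₑ ^ 2 := by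
  have hfc : Continuous (fderiv ℝ f) := hf.continuous_fderiv one_ne_zero
  obtain ⟨c, hc⟩ := (convex_ball z r).exists_poincare (volume : Measure Plane)
    measurableSet_ball (Metric.measure_ball_pos _ _ hr).ne' measure_ball_lt_top.ne hf
    (G := fun x => ENNReal.ofReal (2 * r) * ‖fderiv ℝ f x‖ₑ)
    (Measurable.const_mul (Continuous.measurable (by fun_prop)) _)
    (by
      intro x _ y hy y' hy'
      have hd : ‖y - y'‖ ≤ 2 * r := by
        rw [← dist_eq_norm]
        have := dist_triangle_right y y' z
        rw [Metric.mem_ball] at hy hy'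
        linarith
      rw [mul_comm, ← ofReal_norm, ← ofReal_norm, ← ENNReal.ofReal_mul (norm_nonneg _)]
      exact ENNReal.ofReal_le_ofReal (((fderiv ℝ f _).le_opNorm _).trans (by gcongr)))
  refine ⟨c, hc.trans_eq ?_⟩
  simp only [mul_pow]
  have h4 : (2 : ℝ≥0∞) ^ 2 = ENNReal.ofReal 4 := by
    rw [ENNReal.ofReal_ofNat]
    norm_num
  rw [lintegral_const_mul' _ _ (ENNReal.pow_ne_top ENNReal.ofReal_ne_top), ← mul_assoc,
    finrank_euclideanSpace_fin, ← ENNReal.ofReal_pow (by positivity), h4,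
    ← ENNReal.ofReal_mul (by positivity)]
  congr 2
  ring

end Perforated


/-! ### Filling the holes: C¹ functions on perforated disks -/

section Perforated

/-- The disk `B(z₀, r₀)` without the closed disks of centres `z i` and radii `r i`. -/
def perforated {ι : Type} (z₀ : Plane) (r₀ : ℝ) (z : ι → Plane) (r : ι → ℝ) : Set Plane :=
  Metric.ball z₀ r₀ \ ⋃ i, Metric.closedBall (z i) (r i)

theorem measurableSet_perforated {ι : Type} [Finite ι] (z₀ : Plane) (r₀ : ℝ) (z : ι → Plane)
    (r : ι → ℝ) : MeasurableSet (perforated z₀ r₀ z r) :=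
  measurableSet_ball.diff (MeasurableSet.iUnion fun _ => measurableSet_closedBall)

theorem perforated_subset {ι : Type} (z₀ : Plane) (r₀ : ℝ) (z : ι → Plane) (r : ι → ℝ) :
    perforated z₀ r₀ z r ⊆ Metric.ball z₀ r₀ :=
  Set.sdiff_subset

theorem volume_perforated_lt_top {ι : Type} (z₀ : Plane) (r₀ : ℝ) (z : ι → Plane) (r : ι → ℝ) :
    volume (perforated z₀ r₀ z r) < ⊤ :=
  (measure_mono (perforated_subset z₀ r₀ z r)).trans_lt measure_ball_lt_top

/-- Collars of width `w` around the holes are pairwise disjoint and stay inside the disk. -/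
structure IsCollared {ι : Type} (z₀ : Plane) (r₀ : ℝ) (z : ι → Plane) (r : ι → ℝ) (w : ℝ) :
    Prop where
  pos : 0 < w
  -- The outer radius of a collar is then at most twice the inner one, as the annulus inequality
  -- requires.
  le_radius : ∀ i, w ≤ r i
  inside : ∀ i, dist (z i) z₀ + r i + w ≤ r₀
  apart : ∀ i j, i ≠ j → (r i + w) + (r j + w) ≤ dist (z i) (z j)

namespace IsCollared

variable {ι : Type} {z₀ : Plane} {r₀ : ℝ} {z : ι → Plane} {r : ι → ℝ} {w : ℝ}

theorem eq_of_lt (h : IsCollared z₀ r₀ z r w) {x : Plane} {i j : ι}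
    (hi : dist x (z i) < r i + w) (hj : dist x (z j) < r j + w) : i = j := by
  by_contra hij
  have := h.apart i j hij
  have := dist_triangle_left (z i) (z j) x
  linarith

theorem annulus_subset (h : IsCollared z₀ r₀ z r w) (i : ι) :
    annulus (z i) (r i) (r i + w) ⊆ perforated z₀ r₀ z r := by
  intro x hx
  refine ⟨?_, ?_⟩
  · have := dist_triangle x (z i) z₀
    have := h.inside i
    have := hx.2
    rw [Metric.mem_ball]
    linarith
  · simp only [Set.mem_iUnion, Metric.mem_closedBall, not_exists, not_le]
    intro j
    by_cases hij : i = j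
    · exact hij ▸ hx.1
    · by_contra! hj
      exact hij (h.eq_of_lt hx.2 (hj.trans_lt (lt_add_of_pos_right _ h.pos)))

theorem pairwise_disjoint_annulus (h : IsCollared z₀ r₀ z r w) :
    Pairwise (Function.onFun Disjoint fun i => annulus (z i) (r i) (r i + w)) := by
  intro i j hij
  rw [Function.onFun, Set.disjoint_left]
  intro x hi hj
  exact hij (h.eq_of_lt hi.2 hj.2)

variable [Fintype ι]

theorem sum_setLIntegral_annulus_le (h : IsCollared z₀ r₀ z r w) (g : Plane → ℝ≥0∞) :
    ∑ i, ∫⁻ x in annulus (z i) (r i) (r i + w), g x ≤ ∫⁻ x in perforated z₀ r₀ z r, g x := by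
  calc _ = ∑' i, ∫⁻ x in annulus (z i) (r i) (r i + w), g x := (tsum_fintype _).symm
    _ = ∫⁻ x in ⋃ i, annulus (z i) (r i) (r i + w), g x :=
        (lintegral_iUnion (fun i => (isOpen_annulus _ _ _).measurableSet)
          h.pairwise_disjoint_annulus g).symm
    _ ≤ _ := lintegral_mono_set (Set.iUnion_subset h.annulus_subset)

/-- The function replaced by constants `m i` in the holes, using the collars for the
transition. -/
def fill (z : ι → Plane) (r : ι → ℝ) (w : ℝ) (m : ι → ℝ) (f : Plane → ℝ) (x : Plane) : ℝ :=
  f x - ∑ i, radialCutoff (z i) (r i) w x * (f x - m i)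

/-- The defect of `f` from the constants `m i` in the collars. -/
def collarDefect (z : ι → Plane) (r : ι → ℝ) (w : ℝ) (m : ι → ℝ) (f : Plane → ℝ) (x : Plane) :
    ℝ≥0∞ :=
  ∑ i, (annulus (z i) (r i) (r i + w)).indicator (fun x => ‖f x - m i‖ₑ ^ 2) x

variable {f : Plane → ℝ} {m : ι → ℝ}

theorem contDiff_fill (hf : ContDiff ℝ 1 f) : ContDiff ℝ 1 (fill z r w m f) :=
  hf.sub (ContDiff.sum fun _ _ => (contDiff_radialCutoff _ _ _).mul (hf.sub contDiff_const))

/-- A point lies within reach of at most one cutoff, so a single term of the sum survives, with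
factor in `[0, 1]`. -/
theorem enorm_sub_fill_le (h : IsCollared z₀ r₀ z r w) {x : Plane}
    (hx : x ∈ perforated z₀ r₀ z r) :
    ‖f x - fill z r w m f x‖ₑ ^ 2 ≤ collarDefect z r w m f x := by
  rw [fill, sub_sub_cancel]
  by_cases ha : ∃ i, dist x (z i) < r i + w
  · obtain ⟨i, hi⟩ := ha
    have hri : r i < dist x (z i) := by
      by_contra! hle
      exact hx.2 (Set.mem_iUnion.2 ⟨i, hle⟩)
    rw [Finset.sum_eq_single i]
    · refine le_trans ?_ (Finset.single_le_sum
        (f := fun i => (annulus (z i) (r i) (r i + w)).indicator (fun x => ‖f x - m i‖ₑ ^ 2) x)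
        (fun _ _ => zero_le) (Finset.mem_univ i))
      rw [Set.indicator_of_mem (show x ∈ annulus (z i) (r i) (r i + w) from ⟨hri, hi⟩), enorm_mul]
      gcongr
      refine mul_le_of_le_one_left zero_le ?_
      rw [← ofReal_norm, Real.norm_of_nonneg radialCutoff_nonneg]
      exact ENNReal.ofReal_le_one.2 radialCutoff_le_one
    · intro j _ hj
      rw [radialCutoff_eq_zero (h.pos.trans_le (h.le_radius j)) h.pos, zero_mul]
      by_contra! hlt
      exact hj (h.eq_of_lt hlt hi)
    · simp
  · push Not at ha
    rw [Finset.sum_eq_zero]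
    · simp
    · intro i _
      rw [radialCutoff_eq_zero (h.pos.trans_le (h.le_radius i)) h.pos (ha i), zero_mul]

theorem fderiv_fill (hf : ContDiff ℝ 1 f) (x : Plane) :
    fderiv ℝ (fill z r w m f) x = fderiv ℝ f x - ∑ i, (radialCutoff (z i) (r i) w x • fderiv ℝ f x +
      (f x - m i) • fderiv ℝ (radialCutoff (z i) (r i) w) x) := by
  have hfd := (hf.differentiable one_ne_zero x).hasFDerivAt
  refine HasFDerivAt.fderiv (hfd.sub (HasFDerivAt.fun_sum fun i _ => ?_))
  exact (((contDiff_radialCutoff (z i) (r i) w).differentiable one_ne_zero) x).hasFDerivAt.mul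
    (hfd.sub_const (m i))

/-- With `χ` the cutoff, the gradient is `0` in a hole, `(1 - χ) Df - (f - m i) Dχ` in a collar, and
`Df` elsewhere. Hence the values of `f` in the holes do not contribute. -/
theorem enorm_fderiv_fill_le (h : IsCollared z₀ r₀ z r w) (hf : ContDiff ℝ 1 f) {M : ℝ}
    (hM : ∀ (z : Plane) (r w : ℝ) (x : Plane), 0 < r → 0 < w →
      ‖fderiv ℝ (radialCutoff z r w) x‖ ≤ M / w) {x : Plane} (hx : x ∈ Metric.ball z₀ r₀) :
    ‖fderiv ℝ (fill z r w m f) x‖ₑ ^ 2 ≤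
      2 * (perforated z₀ r₀ z r).indicator (fun x => ‖fderiv ℝ f x‖ₑ ^ 2) x +
      2 * (ENNReal.ofReal ((M / w) ^ 2) * collarDefect z r w m f x) := by
  have hr : ∀ i, 0 < r i := fun i => h.pos.trans_le (h.le_radius i)
  have hw := h.pos
  rw [fderiv_fill hf]
  by_cases ha : ∃ i, dist x (z i) < r i + w
  · obtain ⟨i, hi⟩ := ha
    have hout : ∀ j, j ≠ i → r j + w ≤ dist x (z j) := fun j hj => by
      by_contra! hlt
      exact hj (h.eq_of_lt hlt hi)
    rw [Finset.sum_eq_single i]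
    · by_cases hri : dist x (z i) ≤ r i
      · rw [radialCutoff_eq_one (hr i) hw hri, fderiv_radialCutoff_eq_zero (hr i) hw
          (fun hm => hm.1.not_ge hri), one_smul, smul_zero, add_zero, sub_self, ← ofReal_norm, norm_zero]
        simp
      · have hA : x ∈ annulus (z i) (r i) (r i + w) := ⟨not_le.1 hri, hi⟩
        rw [Set.indicator_of_mem (h.annulus_subset i hA)]
        have e : fderiv ℝ f x - (radialCutoff (z i) (r i) w x • fderiv ℝ f x +
            (f x - m i) • fderiv ℝ (radialCutoff (z i) (r i) w) x) =
            (1 - radialCutoff (z i) (r i) w x) • fderiv ℝ f x +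
            (-(f x - m i)) • fderiv ℝ (radialCutoff (z i) (r i) w) x := by module
        rw [e]
        refine (enorm_add_sq_le _ _).trans ?_
        gcongr
        · rw [enorm_smul]
          refine mul_le_of_le_one_left zero_le ?_
          rw [← ofReal_norm, Real.norm_of_nonneg (sub_nonneg.2 radialCutoff_le_one)]
          exact ENNReal.ofReal_le_one.2 (sub_le_self _ radialCutoff_nonneg)
        · rw [enorm_smul, enorm_neg, mul_comm, mul_pow]
          gcongr
          · rw [← ofReal_norm, ← ENNReal.ofReal_pow (norm_nonneg _)]
            apply ENNReal.ofReal_le_ofReal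
            gcongr
            exact hM _ _ _ _ (hr i) hw
          · refine le_trans ?_ (Finset.single_le_sum
              (f := fun i => (annulus (z i) (r i) (r i + w)).indicator
                (fun x => ‖f x - m i‖ₑ ^ 2) x)
              (fun _ _ => zero_le) (Finset.mem_univ i))
            rw [Set.indicator_of_mem hA]
    · intro j _ hj
      rw [radialCutoff_eq_zero (hr j) hw (hout j hj), fderiv_radialCutoff_eq_zero (hr j) hw
        (fun hm => hm.2.not_ge (hout j hj))]
      simp
    · simp
  · push Not at ha
    have hU : x ∈ perforated z₀ r₀ z r := by
      refine ⟨hx, ?_⟩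
      simp only [Set.mem_iUnion, Metric.mem_closedBall, not_exists, not_le]
      intro i
      linarith [ha i]
    rw [Finset.sum_eq_zero, sub_zero, Set.indicator_of_mem hU]
    · refine le_trans ?_ le_self_add
      rw [two_mul]
      exact le_self_add
    · intro i _
      rw [radialCutoff_eq_zero (hr i) hw (ha i), fderiv_radialCutoff_eq_zero (hr i) hw
        (fun hm => hm.2.not_ge (ha i))]
      simp

/-- The disjoint collars have total energy at most that of the domain, and each has outer radius at
most `r₀`. This is where uniformity in the number of holes arises. -/
theorem lintegral_collarDefect_le (h : IsCollared z₀ r₀ z r w) (hf : ContDiff ℝ 1 f)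
    (hm : ∀ i, ∫⁻ x in annulus (z i) (r i) (r i + w), ‖f x - m i‖ₑ ^ 2 ≤
      ENNReal.ofReal (512 * (r i + w) ^ 2) *
        ∫⁻ x in annulus (z i) (r i) (r i + w), ‖fderiv ℝ f x‖ₑ ^ 2) :
    ∫⁻ x, collarDefect z r w m f x ≤
      ENNReal.ofReal (512 * r₀ ^ 2) * ∫⁻ x in perforated z₀ r₀ z r, ‖fderiv ℝ f x‖ₑ ^ 2 := by
  have hfc : Continuous f := hf.continuous
  unfold collarDefect
  rw [lintegral_finsetSum _ fun i _ => (Continuous.measurable (by fun_prop)).indicator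
    (isOpen_annulus _ _ _).measurableSet]
  calc _ = ∑ i, ∫⁻ x in annulus (z i) (r i) (r i + w), ‖f x - m i‖ₑ ^ 2 :=
        Finset.sum_congr rfl fun i _ => lintegral_indicator (isOpen_annulus _ _ _).measurableSet _
    _ ≤ ∑ i, ENNReal.ofReal (512 * r₀ ^ 2) *
          ∫⁻ x in annulus (z i) (r i) (r i + w), ‖fderiv ℝ f x‖ₑ ^ 2 := by
        refine Finset.sum_le_sum fun i _ => (hm i).trans ?_
        have h1 := h.inside i
        have h2 := h.le_radius i
        have h3 := h.pos
        have h4 := dist_nonneg (x := z i) (y := z₀)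
        have h5 : r i + w ≤ r₀ := by linarith
        have h6 : 0 ≤ r i + w := by linarith
        gcongr
    _ ≤ _ := by
        rw [← Finset.mul_sum]
        gcongr
        exact h.sum_setLIntegral_annulus_le _

end IsCollared

/-- **Poincaré inequality for perforated disks with collared holes**, for functions of class `C¹`:
the constant depends only on a lower bound for the relative width of the collars. -/
theorem exists_poincare_perforated {a : ℝ} (ha : 0 < a) :
    ∃ C : ℝ, 0 < C ∧ ∀ (ι : Type) [Fintype ι] (z₀ : Plane) (r₀ : ℝ) (z : ι → Plane) (r : ι → ℝ)
      (w : ℝ), 0 < r₀ → a * r₀ ≤ w → IsCollared z₀ r₀ z r w →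
      ∀ f : Plane → ℝ, ContDiff ℝ 1 f → ∃ c : ℝ,
        ∫⁻ x in perforated z₀ r₀ z r, ‖f x - c‖ₑ ^ 2 ≤
          ENNReal.ofReal (C * r₀ ^ 2) * ∫⁻ x in perforated z₀ r₀ z r, ‖fderiv ℝ f x‖ₑ ^ 2 := by
  obtain ⟨M, hM0, hM⟩ := exists_norm_fderiv_radialCutoff_le
  -- `f - c` splits into the filled function minus `c`, costing `2 * 16` times its energy factor `2
  -- + 1024 * (M / a) ^ 2`, and the defect, costing `2 * 512`. The inner `1024` is also `2 * 512`,
  -- from the defect in the gradient bound.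
  refine ⟨32 * (2 + 1024 * (M / a) ^ 2) + 1024, by positivity, ?_⟩
  intro ι _ z₀ r₀ z r w hr₀ hw h f hf
  have hr : ∀ i, 0 < r i := fun i => h.pos.trans_le (h.le_radius i)
  have hm : ∀ i, ∃ m : ℝ, ∫⁻ x in annulus (z i) (r i) (r i + w), ‖f x - m‖ₑ ^ 2 ≤
      ENNReal.ofReal (512 * (r i + w) ^ 2) *
        ∫⁻ x in annulus (z i) (r i) (r i + w), ‖fderiv ℝ f x‖ₑ ^ 2 := fun i =>
    exists_poincare_annulus (z i) (hr i) (by linarith [h.pos]) (by linarith [h.le_radius i]) hf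
  choose m hm using hm
  have hdef := h.lintegral_collarDefect_le hf hm
  set D := ∫⁻ x in perforated z₀ r₀ z r, ‖fderiv ℝ f x‖ₑ ^ 2 with hD
  have hfc : Continuous f := hf.continuous
  have hfdc : Continuous (fderiv ℝ f) := hf.continuous_fderiv one_ne_zero
  have hU := measurableSet_perforated z₀ r₀ z r
  have hUB : perforated z₀ r₀ z r ⊆ Metric.ball z₀ r₀ := perforated_subset z₀ r₀ z r
  have hg : ContDiff ℝ 1 (IsCollared.fill z r w m f) := IsCollared.contDiff_fill hf
  obtain ⟨c, hc⟩ := exists_poincare_ball z₀ hr₀ hg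
  have h2 : (2 : ℝ≥0∞) = ENNReal.ofReal 2 := by simp
  have hgrad : ∫⁻ x in Metric.ball z₀ r₀, ‖fderiv ℝ (IsCollared.fill z r w m f) x‖ₑ ^ 2 ≤
      ENNReal.ofReal (2 + 1024 * (M / a) ^ 2) * D := by
    calc _ ≤ ∫⁻ x in Metric.ball z₀ r₀,
          (2 * (perforated z₀ r₀ z r).indicator (fun x => ‖fderiv ℝ f x‖ₑ ^ 2) x +
            2 * (ENNReal.ofReal ((M / w) ^ 2) * IsCollared.collarDefect z r w m f x)) :=
          setLIntegral_mono' measurableSet_ball fun x hx => h.enorm_fderiv_fill_le hf hM hx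
      _ = 2 * (∫⁻ x in Metric.ball z₀ r₀,
            (perforated z₀ r₀ z r).indicator (fun x => ‖fderiv ℝ f x‖ₑ ^ 2) x) +
          2 * (ENNReal.ofReal ((M / w) ^ 2) *
            ∫⁻ x in Metric.ball z₀ r₀, IsCollared.collarDefect z r w m f x) := by
          rw [lintegral_add_left, lintegral_const_mul' _ _ (by simp),
            lintegral_const_mul' _ _ (by simp), lintegral_const_mul' _ _ (by simp)]
          exact Measurable.const_mul
            ((Continuous.measurable (by fun_prop)).indicator hU) _
      _ ≤ 2 * D + 2 * (ENNReal.ofReal ((M / w) ^ 2) * (ENNReal.ofReal (512 * r₀ ^ 2) * D)) := by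
          gcongr
          · rw [setLIntegral_indicator hU, Set.inter_eq_left.2 hUB]
          · exact (setLIntegral_le_lintegral _ _).trans hdef
      _ = ENNReal.ofReal (2 + 2 * ((M / w) ^ 2 * (512 * r₀ ^ 2))) * D := by
          rw [ENNReal.ofReal_add (by positivity) (by positivity),
            ENNReal.ofReal_mul (by norm_num : (0 : ℝ) ≤ 2),
            ENNReal.ofReal_mul (by positivity : (0 : ℝ) ≤ (M / w) ^ 2), ← h2]
          ring
      _ ≤ _ := by
          refine mul_le_mul_left (ENNReal.ofReal_le_ofReal ?_) _
          have : M / w * r₀ ≤ M / a := by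
            rw [div_mul_eq_mul_div, div_le_div_iff₀ h.pos ha]
            nlinarith
          have h3 : (M / w * r₀) ^ 2 ≤ (M / a) ^ 2 := by
            have := h.pos
            gcongr
          nlinarith
  refine ⟨c, ?_⟩
  calc ∫⁻ x in perforated z₀ r₀ z r, ‖f x - c‖ₑ ^ 2
      ≤ ∫⁻ x in perforated z₀ r₀ z r, (2 * ‖IsCollared.fill z r w m f x - c‖ₑ ^ 2 +
          2 * IsCollared.collarDefect z r w m f x) := by
        refine setLIntegral_mono' hU fun x hx => ?_
        have e : f x - c = (IsCollared.fill z r w m f x - c) +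
          (f x - IsCollared.fill z r w m f x) := by ring
        rw [e]
        refine (enorm_add_sq_le _ _).trans ?_
        gcongr
        exact h.enorm_sub_fill_le hx
    _ = 2 * (∫⁻ x in perforated z₀ r₀ z r, ‖IsCollared.fill z r w m f x - c‖ₑ ^ 2) +
          2 * ∫⁻ x in perforated z₀ r₀ z r, IsCollared.collarDefect z r w m f x := by
        rw [lintegral_add_left, lintegral_const_mul' _ _ (by simp),
            lintegral_const_mul' _ _ (by simp)]
        have := hg.continuous
        exact (Continuous.measurable (by fun_prop)).const_mul _
    _ ≤ 2 * (ENNReal.ofReal (16 * r₀ ^ 2) * (ENNReal.ofReal (2 + 1024 * (M / a) ^ 2) * D)) +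
          2 * (ENNReal.ofReal (512 * r₀ ^ 2) * D) := by
        gcongr
        · exact (lintegral_mono_set hUB).trans (hc.trans (by gcongr))
        · exact (setLIntegral_le_lintegral _ _).trans hdef
    _ = ENNReal.ofReal (2 * (16 * r₀ ^ 2 * (2 + 1024 * (M / a) ^ 2)) + 2 * (512 * r₀ ^ 2)) * D := by
        rw [ENNReal.ofReal_add (p := 2 * _) (by positivity) (by positivity),
            ENNReal.ofReal_mul (by norm_num : (0 : ℝ) ≤ 2),
            ENNReal.ofReal_mul (by norm_num : (0 : ℝ) ≤ 2),
            ENNReal.ofReal_mul (by positivity : (0 : ℝ) ≤ 16 * r₀ ^ 2), ← h2]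
        ring
    _ = _ := by
        congr 2
        ring

end Perforated


/-! ### Mollification of H¹ functions away from the boundary -/

section Mollification

open Filter Topology
open scoped Convolution

theorem lintegral_enorm_sq_eq {α V : Type*} [MeasurableSpace α] [NormedAddCommGroup V]
    (μ : Measure α) (f : α → V) : ∫⁻ x, ‖f x‖ₑ ^ 2 ∂μ = eLpNorm f 2 μ ^ 2 := by
  have := eLpNorm_nnreal_pow_eq_lintegral (f := f) (μ := μ) (p := 2) two_ne_zero
  simpa using this.symm

/-- The mollification of the extension by zero of `φ` outside `U`. -/
def mollify (U : Set Plane) (φ : Plane → ℝ) (k : ContDiffBump (0 : Plane)) : Plane → ℝ :=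
  k.normed volume ⋆[ContinuousLinearMap.lsmul ℝ ℝ, volume] U.indicator φ

variable {U : Set Plane} {φ : Plane → ℝ} {g : Plane → Plane} (k : ContDiffBump (0 : Plane))

theorem locallyIntegrable_indicator_of_memLp {V : Type*} [NormedAddCommGroup V]
    {f : Plane → V} (hU : MeasurableSet U) (hf : MemLp f 2 (volume.restrict U)) :
    LocallyIntegrable (U.indicator f) :=
  ((memLp_indicator_iff_restrict hU).2 hf).locallyIntegrable (by norm_num)

theorem contDiff_mollify (hφ : LocallyIntegrable (U.indicator φ)) :
    ContDiff ℝ 1 (mollify U φ k) :=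
  k.hasCompactSupport_normed.contDiff_convolution_left _ (n := 1) k.contDiff_normed hφ

/-- The reflected kernel `t ↦ η(x - t)` is a test function supported in the closed ball about `x`,
hence in `U`. The sign from the reflection cancels the one in the definition of the weak gradient.
-/
theorem fderiv_mollify_apply (hU : MeasurableSet U) (hφ : LocallyIntegrable (U.indicator φ))
    (hg : HasWeakGradientOn U φ g) {x : Plane} (hx : Metric.closedBall x k.rOut ⊆ U)
    (v : Plane) :
    fderiv ℝ (mollify U φ k) x v =
      ∫ t in U, inner ℝ (g t) v * k.normed volume (x - t) := by
  have hk1 : ContDiff ℝ 1 (k.normed (volume : Measure Plane)) := k.contDiff_normed (n := 1)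
  have hkc := k.hasCompactSupport_normed (μ := (volume : Measure Plane))
  have hD := hkc.hasFDerivAt_convolution_left (ContinuousLinearMap.lsmul ℝ ℝ) hk1 hφ x
  have hint := (hkc.fderiv ℝ).convolutionExists_left
    ((ContinuousLinearMap.lsmul ℝ ℝ).precompL Plane) (hk1.continuous_fderiv one_ne_zero) hφ x
  rw [mollify, hD.fderiv, convolution_def, ContinuousLinearMap.integral_apply hint]
  simp only [ContinuousLinearMap.precompL_apply, ContinuousLinearMap.lsmul_apply, smul_eq_mul]
  rw [← integral_sub_left_eq_self _ _ x]
  simp only [sub_sub_cancel]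
  set ψ : Plane → ℝ := fun t => k.normed volume (x - t) with hψ
  have hψd : ∀ t, fderiv ℝ ψ t v = -fderiv ℝ (k.normed volume) (x - t) v := by
    intro t
    have h1 : HasFDerivAt (fun t : Plane => x - t) (-ContinuousLinearMap.id ℝ Plane) t :=
      (hasFDerivAt_id t).const_sub x
    have := ((hk1.differentiable one_ne_zero (x - t)).hasFDerivAt.comp t h1).fderiv
    simp only [hψ]
    change fderiv ℝ (k.normed volume ∘ fun t => x - t) t v = _
    rw [this]
    simp
  have hψs : tsupport ψ ⊆ Metric.closedBall x k.rOut := by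
    refine closure_minimal ?_ Metric.isClosed_closedBall
    intro t ht
    have : x - t ∈ Function.support (k.normed (volume : Measure Plane)) := ht
    rw [k.support_normed_eq, mem_ball_zero_iff] at this
    rw [Metric.mem_closedBall, dist_comm, dist_eq_norm]
    exact this.le
  have hw := hg.2.2 ψ (k.contDiff_normed.comp (contDiff_const.sub contDiff_id))
    (HasCompactSupport.of_support_subset_isCompact (isCompact_closedBall x k.rOut)
      (subset_closure.trans hψs)) (hψs.trans hx) v
  calc ∫ t, fderiv ℝ (k.normed volume) (x - t) v * U.indicator φ t
      = ∫ t in U, φ t * -fderiv ℝ ψ t v := by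
        rw [← integral_indicator hU]
        congr 1
        ext t
        by_cases ht : t ∈ U
        · simp only [Set.indicator_of_mem ht, hψd, neg_neg, mul_comm]
        · simp only [Set.indicator_of_notMem ht, mul_zero]
    _ = ∫ t in U, inner ℝ (g t) v * ψ t := by
        simp only [mul_neg, integral_neg, hw, neg_neg]

theorem enorm_fderiv_mollify_le (hU : MeasurableSet U) (hφ : LocallyIntegrable (U.indicator φ))
    (hg : HasWeakGradientOn U φ g) {x : Plane} (hx : Metric.closedBall x k.rOut ⊆ U) :
    ‖fderiv ℝ (mollify U φ k) x‖ₑ ≤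
      ∫⁻ t in U, ENNReal.ofReal (k.normed volume (x - t)) * ‖g t‖ₑ := by
  set J := ∫⁻ t in U, ENNReal.ofReal (k.normed volume (x - t)) * ‖g t‖ₑ with hJ
  rcases eq_or_ne J ⊤ with h | h
  · rw [h]
    exact le_top
  · rw [← ofReal_norm]
    refine ENNReal.ofReal_le_of_le_toReal ?_
    refine ContinuousLinearMap.opNorm_le_bound _ ENNReal.toReal_nonneg fun v => ?_
    rw [fderiv_mollify_apply k hU hφ hg hx, ← toReal_enorm, ← toReal_enorm v, ← ENNReal.toReal_mul]
    refine ENNReal.toReal_mono (ENNReal.mul_ne_top h enorm_ne_top) ?_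
    refine (enorm_integral_le_lintegral_enorm _).trans ?_
    rw [hJ, ← lintegral_mul_const' _ _ enorm_ne_top]
    refine lintegral_mono fun t => ?_
    rw [enorm_mul, ← ofReal_norm (k.normed volume (x - t)), Real.norm_of_nonneg (k.nonneg_normed _),
      mul_comm, mul_assoc]
    gcongr
    rw [← ofReal_norm, ← ofReal_norm, ← ofReal_norm, ← ENNReal.ofReal_mul (norm_nonneg _)]
    exact ENNReal.ofReal_le_ofReal (norm_inner_le_norm _ _)

theorem lintegral_normed_sub_left (x : Plane) :
    ∫⁻ t, ENNReal.ofReal (k.normed (volume : Measure Plane) (x - t)) = 1 := by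
  rw [lintegral_sub_left_eq_self (fun t => ENNReal.ofReal (k.normed (volume : Measure Plane) t)),
    ← ofReal_integral_eq_lintegral_ofReal k.integrable_normed (.of_forall k.nonneg_normed),
    k.integral_normed, ENNReal.ofReal_one]

theorem lintegral_normed_sub_right (t : Plane) :
    ∫⁻ x, ENNReal.ofReal (k.normed (volume : Measure Plane) (x - t)) = 1 := by
  rw [lintegral_sub_right_eq_self (fun t => ENNReal.ofReal (k.normed (volume : Measure Plane) t)),
    ← ofReal_integral_eq_lintegral_ofReal k.integrable_normed (.of_forall k.nonneg_normed),
    k.integral_normed, ENNReal.ofReal_one]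

/-- Jensen's inequality for the probability measure with density `η(x - ·)`. -/
theorem sq_lintegral_normed_mul_le {h : Plane → ℝ≥0∞} (hh : AEMeasurable h) (x : Plane) :
    (∫⁻ t, ENNReal.ofReal (k.normed volume (x - t)) * h t) ^ 2 ≤
      ∫⁻ t, ENNReal.ofReal (k.normed volume (x - t)) * h t ^ 2 := by
  set d : Plane → ℝ≥0∞ := fun t => ENNReal.ofReal (k.normed volume (x - t)) with hd
  have hdm : Measurable d := by
    have := k.continuous_normed (μ := (volume : Measure Plane))
    exact (Continuous.measurable (by fun_prop)).ennreal_ofReal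
  have : IsProbabilityMeasure ((volume : Measure Plane).withDensity d) :=
    ⟨by rw [withDensity_apply _ .univ, Measure.restrict_univ]; exact lintegral_normed_sub_left k x⟩
  have h1 := sq_lintegral_le_lintegral_sq ((volume : Measure Plane).withDensity d)
    (hh.mono_ac (withDensity_absolutelyContinuous _ _))
  rwa [lintegral_withDensity_eq_lintegral_mul₀ hdm.aemeasurable hh,
    lintegral_withDensity_eq_lintegral_mul₀ hdm.aemeasurable (hh.pow_const 2)] at h1

/-- Mollification does not increase the Dirichlet energy. -/
theorem lintegral_fderiv_mollify_le (hU : MeasurableSet U) (h : MemSobolevH1 U φ g) {A : Set Plane}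
    (hA : MeasurableSet A) (hAU : ∀ x ∈ A, Metric.closedBall x k.rOut ⊆ U) :
    ∫⁻ x in A, ‖fderiv ℝ (mollify U φ k) x‖ₑ ^ 2 ≤ ∫⁻ x in U, ‖g x‖ₑ ^ 2 := by
  have hφ := locallyIntegrable_indicator_of_memLp hU h.1
  set e : Plane → ℝ≥0∞ := U.indicator fun t => ‖g t‖ₑ with he
  have hem : AEMeasurable e :=
    (aemeasurable_indicator_iff hU).2 h.2.1.1.enorm
  have heq : ∀ x, ∫⁻ t in U, ENNReal.ofReal (k.normed volume (x - t)) * ‖g t‖ₑ =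
      ∫⁻ t, ENNReal.ofReal (k.normed volume (x - t)) * e t := by
    intro x
    rw [← lintegral_indicator hU]
    congr 1
    ext t
    by_cases ht : t ∈ U <;> simp [he, ht]
  calc ∫⁻ x in A, ‖fderiv ℝ (mollify U φ k) x‖ₑ ^ 2
      ≤ ∫⁻ x in A, ∫⁻ t, ENNReal.ofReal (k.normed volume (x - t)) * e t ^ 2 := by
        refine setLIntegral_mono' hA fun x hx => ?_
        refine le_trans ?_ (sq_lintegral_normed_mul_le k hem x)
        rw [← heq]
        gcongr
        exact enorm_fderiv_mollify_le k hU hφ h.2.2 (hAU x hx)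
    _ ≤ ∫⁻ x, ∫⁻ t, ENNReal.ofReal (k.normed volume (x - t)) * e t ^ 2 :=
        setLIntegral_le_lintegral _ _
    _ = ∫⁻ t, ∫⁻ x, ENNReal.ofReal (k.normed volume (x - t)) * e t ^ 2 := by
        apply lintegral_lintegral_swap
        have := k.continuous_normed (μ := (volume : Measure Plane))
        have h1 : Measurable fun p : Plane × Plane =>
            ENNReal.ofReal (k.normed volume (p.1 - p.2)) :=
          (Continuous.measurable (by fun_prop)).ennreal_ofReal
        exact h1.aemeasurable.mul
          ((hem.pow_const 2).comp_quasiMeasurePreserving Measure.quasiMeasurePreserving_snd)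
    _ = ∫⁻ t, e t ^ 2 := by
        congr 1
        ext t
        have := k.continuous_normed (μ := (volume : Measure Plane))
        rw [lintegral_mul_const _ (Continuous.measurable (by fun_prop)).ennreal_ofReal,
          lintegral_normed_sub_right, one_mul]
    _ = ∫⁻ x in U, ‖g x‖ₑ ^ 2 := by
        rw [← lintegral_indicator hU]
        congr 1
        ext t
        by_cases ht : t ∈ U <;> simp [he, ht]

end Mollification

/-! ### Passage to the limit and removal of the constant -/

section Limit

open Filter Topology

/-- Deviation bounds on an exhausting sequence of sets pass to the limit, up to a factor `4`. -/
theorem exists_setLIntegral_le_of_tendsto {α : Type*} [MeasurableSpace α] {μ : Measure α}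
    {U : Set α} (hμU : μ U ≠ ⊤) {E : ℕ → Set α}
    (hE : ∀ n, MeasurableSet (E n)) (hEU : ∀ n, E n ⊆ U) (hUE : ∀ x ∈ U, ∀ᶠ n in atTop, x ∈ E n)
    (hU : MeasurableSet U) {f : ℕ → α → ℝ} (hf : ∀ n, Measurable (f n)) {φ : α → ℝ}
    (hφ : AEStronglyMeasurable φ (μ.restrict U))
    (hlim : ∀ᵐ x ∂μ.restrict U, Tendsto (fun n => f n x) atTop (𝓝 (φ x))) {K : ℝ≥0∞}
    (hK : ∀ n, ∃ c : ℝ, ∫⁻ x in E n, ‖f n x - c‖ₑ ^ 2 ∂μ ≤ K) :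
    ∃ c : ℝ, ∫⁻ x in U, ‖φ x - c‖ₑ ^ 2 ∂μ ≤ 4 * K := by
  rcases eq_or_ne (μ U) 0 with h0 | h0
  · exact ⟨0, by simp [Measure.restrict_eq_zero.2 h0]⟩
  have hfin : IsFiniteMeasure (μ.restrict U) := ⟨by simpa using hμU.lt_top⟩
  set ν := μ.restrict U with hν
  have hφ' : AEMeasurable φ ν := hφ.aemeasurable
  -- The constants `c` vary with `n` and are not known to converge. Differences on the product do
  -- not see them, so Fatou's lemma applies there; a good point `x` then supplies the limiting
  -- constant. The factor `4` is `2 + 2` from splitting a difference around `c`.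
  set F : ℕ → α × α → ℝ≥0∞ := fun n => (E n ×ˢ E n).indicator fun p => ‖f n p.2 - f n p.1‖ₑ ^ 2
  have hFm : ∀ n, Measurable (F n) := fun n =>
    Measurable.indicator
      ((((hf n).comp measurable_snd).sub ((hf n).comp measurable_fst)).enorm.pow_const 2)
      ((hE n).prod (hE n))
  have hFle : ∀ n, ∫⁻ p, F n p ∂ν.prod ν ≤ μ U * (4 * K) := by
    intro n
    obtain ⟨c, hc⟩ := hK n
    have hνE : ν.restrict (E n) = μ.restrict (E n) := by
      rw [hν, Measure.restrict_restrict (hE n), Set.inter_eq_left.2 (hEU n)]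
    have hmeas : Measurable fun x => ‖f n x - c‖ₑ ^ 2 := ((hf n).sub_const c).enorm.pow_const 2
    rw [lintegral_indicator ((hE n).prod (hE n)), ← Measure.prod_restrict, hνE]
    have : IsFiniteMeasure (μ.restrict (E n)) :=
      ⟨by simpa using (measure_mono (hEU n)).trans_lt hμU.lt_top⟩
    calc _ ≤ ∫⁻ p, (2 * ‖f n p.2 - c‖ₑ ^ 2 + 2 * ‖f n p.1 - c‖ₑ ^ 2)
          ∂(μ.restrict (E n)).prod (μ.restrict (E n)) := by
          refine lintegral_mono fun p => ?_
          have e : f n p.2 - f n p.1 = (f n p.2 - c) + (-(f n p.1 - c)) := by ring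
          rw [e]
          refine (enorm_add_sq_le _ _).trans_eq ?_
          rw [enorm_neg]
      _ = ∫⁻ x in E n, ∫⁻ y in E n, (2 * ‖f n y - c‖ₑ ^ 2 + 2 * ‖f n x - c‖ₑ ^ 2) ∂μ ∂μ := by
          rw [lintegral_prod]
          exact (((hmeas.comp measurable_snd).const_mul 2).add
            ((hmeas.comp measurable_fst).const_mul 2)).aemeasurable
      _ = 4 * (μ (E n) * ∫⁻ x in E n, ‖f n x - c‖ₑ ^ 2 ∂μ) := by
          simp_rw [lintegral_add_left (hmeas.const_mul 2), lintegral_const_mul _ hmeas,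
            lintegral_const, Measure.restrict_apply_univ]
          rw [lintegral_add_left measurable_const, lintegral_const, Measure.restrict_apply_univ,
            lintegral_mul_const _ (hmeas.const_mul 2), lintegral_const_mul _ hmeas]
          ring
      _ ≤ 4 * (μ U * K) := by
          gcongr
          exact hEU n
      _ = _ := by ring
  have hFlim : ∀ᵐ p ∂ν.prod ν,
      liminf (fun n => F n p) atTop = ‖φ p.2 - φ p.1‖ₑ ^ 2 := by
    have hU' : ∀ᵐ x ∂ν, x ∈ U := ae_restrict_mem hU
    filter_upwards [Measure.quasiMeasurePreserving_fst.ae hlim,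
      Measure.quasiMeasurePreserving_snd.ae hlim, Measure.quasiMeasurePreserving_fst.ae hU',
      Measure.quasiMeasurePreserving_snd.ae hU'] with p h1 h2 h3 h4
    apply Tendsto.liminf_eq
    have ht : Tendsto (fun n => ‖f n p.2 - f n p.1‖ₑ ^ 2) atTop (𝓝 (‖φ p.2 - φ p.1‖ₑ ^ 2)) :=
      ((ENNReal.continuous_pow 2).tendsto _).comp ((h2.sub h1).enorm)
    refine ht.congr' ?_
    filter_upwards [hUE _ h3, hUE _ h4] with n hn1 hn2
    simp only [F]
    rw [Set.indicator_of_mem (show p ∈ E n ×ˢ E n from ⟨hn1, hn2⟩)]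
  have hdouble : ∫⁻ x in U, ∫⁻ y in U, ‖φ y - φ x‖ₑ ^ 2 ∂μ ∂μ ≤ μ U * (4 * K) := by
    calc _ = ∫⁻ p, ‖φ p.2 - φ p.1‖ₑ ^ 2 ∂ν.prod ν := by
          rw [lintegral_prod]
          exact (((hφ'.comp_quasiMeasurePreserving Measure.quasiMeasurePreserving_snd).sub
            (hφ'.comp_quasiMeasurePreserving Measure.quasiMeasurePreserving_fst)).enorm).pow_const 2
      _ = ∫⁻ p, liminf (fun n => F n p) atTop ∂ν.prod ν :=
          lintegral_congr_ae (hFlim.mono fun p hp => hp.symm)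
      _ ≤ liminf (fun n => ∫⁻ p, F n p ∂ν.prod ν) atTop := lintegral_liminf_le hFm
      _ ≤ _ := liminf_le_of_frequently_le' (.of_forall hFle)
  obtain ⟨x, hx⟩ := exists_setLIntegral_le_of_double_le h0 hμU
    (F := fun x y => ‖φ y - φ x‖ₑ ^ 2) (by
      have : AEMeasurable (fun p : α × α => ‖φ p.2 - φ p.1‖ₑ ^ 2) (ν.prod ν) :=
        (((hφ'.comp_quasiMeasurePreserving Measure.quasiMeasurePreserving_snd).sub
            (hφ'.comp_quasiMeasurePreserving Measure.quasiMeasurePreserving_fst)).enorm).pow_const 2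
      exact this.lintegral_prod_right') hdouble
  exact ⟨φ x, hx⟩

/-- For mean zero the cross term vanishes: subtracting `c` adds `c ^ 2` times the total mass. -/
theorem lintegral_sq_le_of_integral_eq_zero {α : Type*} [MeasurableSpace α] {μ : Measure α}
    [IsFiniteMeasure μ] {φ : α → ℝ} (hφ : MemLp φ 2 μ) (h0 : ∫ x, φ x ∂μ = 0) (c : ℝ) :
    ∫⁻ x, ‖φ x‖ₑ ^ 2 ∂μ ≤ ∫⁻ x, ‖φ x - c‖ₑ ^ 2 ∂μ := by
  have hc : MemLp (fun x => φ x - c) 2 μ := hφ.sub (memLp_const c)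
  have key : ∀ {u : α → ℝ}, MemLp u 2 μ →
      ∫⁻ x, ‖u x‖ₑ ^ 2 ∂μ = ENNReal.ofReal (∫ x, u x ^ 2 ∂μ) := by
    intro u hu
    rw [ofReal_integral_eq_lintegral_ofReal hu.integrable_sq (.of_forall fun x => sq_nonneg _)]
    congr 1
    ext x
    rw [← ofReal_norm, ← ENNReal.ofReal_pow (norm_nonneg _), Real.norm_eq_abs, sq_abs]
  rw [key hφ, key hc]
  apply ENNReal.ofReal_le_ofReal
  have hi : Integrable φ μ := hφ.integrable (by norm_num)
  have e : ∫ x, (φ x - c) ^ 2 ∂μ = ∫ x, φ x ^ 2 ∂μ + ∫ x, (c ^ 2 - 2 * c * φ x) ∂μ := by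
    have hi' : Integrable (fun x => c ^ 2 - 2 * c * φ x) μ :=
      (integrable_const _).sub (hi.const_mul _)
    rw [← integral_add hφ.integrable_sq hi']
    congr 1
    ext x
    ring
  rw [e, integral_sub (integrable_const _) (hi.const_mul _), integral_const_mul, h0, mul_zero,
    sub_zero, integral_const, smul_eq_mul]
  have : 0 ≤ μ.real Set.univ * c ^ 2 := by positivity
  linarith

end Limit


/-! ### From the separation number to collars -/

namespace PerforatedDisk

variable {E : PerforatedDisk} {δ : ℝ}

/-- The holes, as indices. -/
abbrev Hole (E : PerforatedDisk) : Type := {i : Fin (E.n + 1) // i ≠ 0}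

theorem domain_eq_perforated (E : PerforatedDisk) :
    E.domain = perforated (E.z 0) (E.r 0) (fun i : E.Hole => E.z i) (fun i => E.r i) := by
  rw [domain, perforated, Set.iUnion_subtype]

theorem le_dist_of_mem_family (hδ : 0 < δ) (hE : E ∈ family δ) {i j : Fin (E.n + 1)} (hij : i ≠ j)
    {p q : Plane} (hp : dist p (E.z i) = E.r i) (hq : dist q (E.z j) = E.r j) :
    2 * δ * E.r 0 ≤ dist p q := by
  have h0 : 0 < 2 * E.r 0 := by have := E.r_pos 0; linarith
  have h1 : ENNReal.ofReal δ * ENNReal.ofReal (2 * E.r 0) ≤ _ :=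
    (ENNReal.le_div_iff_mul_le (.inl (by simpa using E.r_pos 0)) (.inl ENNReal.ofReal_ne_top)).1 hE
  have h2 := h1.trans (min_le_left _ _)
  simp only [le_iInf_iff, setDist] at h2
  have h3 := h2 i j hij p hp q hq
  rw [← ENNReal.ofReal_mul hδ.le, edist_dist, ENNReal.ofReal_le_ofReal_iff dist_nonneg] at h3
  linarith

theorem le_radius_of_mem_family (hδ : 0 < δ) (hE : E ∈ family δ) {i : Fin (E.n + 1)} (hi : i ≠ 0) :
    2 * δ * E.r 0 ≤ E.r i := by
  have h1 : ENNReal.ofReal δ * ENNReal.ofReal (2 * E.r 0) ≤ _ :=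
    (ENNReal.le_div_iff_mul_le (.inl (by simpa using E.r_pos 0)) (.inl ENNReal.ofReal_ne_top)).1 hE
  have h2 := h1.trans (min_le_right _ _)
  simp only [le_iInf_iff] at h2
  have h3 := h2 i hi
  rw [← ENNReal.ofReal_mul hδ.le, ENNReal.ofReal_le_ofReal_iff (E.r_pos i).le] at h3
  linarith

/-- The distance bound is applied to the two points where the segment of centres leaves one circle
and enters the other. Disjointness of the closed disks puts them in that order, which fixes the sign
of the gap. -/
theorem add_le_dist_of_mem_family (hδ : 0 < δ) (hE : E ∈ family δ) {i j : Fin (E.n + 1)}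
    (hi : i ≠ 0) (hj : j ≠ 0) (hij : i ≠ j) :
    E.r i + E.r j + 2 * δ * E.r 0 ≤ dist (E.z i) (E.z j) := by
  have hri := E.r_pos i
  have hrj := E.r_pos j
  have hd := (disjoint_closedBall_closedBall_iff hri.le hrj.le).1 (E.holes_disjoint i j hi hj hij)
  set D := dist (E.z i) (E.z j) with hD
  have hD0 : 0 < D := by linarith
  have hn : ‖E.z j - E.z i‖ = D := by rw [hD, dist_comm, dist_eq_norm]
  have h := le_dist_of_mem_family hδ hE hij (p := E.z i + (E.r i / D) • (E.z j - E.z i))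
    (q := E.z j - (E.r j / D) • (E.z j - E.z i))
    (by
      rw [dist_self_add_left, norm_smul, hn, Real.norm_of_nonneg (by positivity)]
      field_simp)
    (by
      rw [dist_eq_norm, sub_sub_cancel_left, norm_neg, norm_smul, hn,
        Real.norm_of_nonneg (by positivity)]
      field_simp)
  have e : (E.z j - (E.r j / D) • (E.z j - E.z i)) - (E.z i + (E.r i / D) • (E.z j - E.z i)) =
      (1 - E.r j / D - E.r i / D) • (E.z j - E.z i) := by module
  have hpos : 0 ≤ 1 - E.r j / D - E.r i / D := by
    rw [sub_sub, ← add_div, sub_nonneg, div_le_one hD0]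
    linarith
  rw [dist_comm, dist_eq_norm, e, norm_smul, hn, Real.norm_of_nonneg hpos] at h
  have : (1 - E.r j / D - E.r i / D) * D = D - E.r j - E.r i := by field_simp
  linarith

theorem exists_unit_direction (v : Plane) : ∃ e : Plane, ‖e‖ = 1 ∧ v = ‖v‖ • e := by
  rcases eq_or_ne v 0 with rfl | hv
  · obtain ⟨e, he⟩ := exists_norm_eq Plane zero_le_one
    exact ⟨e, he, by simp⟩
  · exact ⟨‖v‖⁻¹ • v, norm_smul_inv_norm hv, by
      rw [smul_smul, mul_inv_cancel₀ (norm_ne_zero_iff.2 hv), one_smul]⟩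

/-- The point of the hole farthest from `z 0` is compared with the point of the outer circle in the
same direction `e`, which is arbitrary when the centres coincide. Inclusion of the closed disks
fixes the sign. -/
theorem dist_add_le_of_mem_family (hδ : 0 < δ) (hE : E ∈ family δ) {i : Fin (E.n + 1)}
    (hi : i ≠ 0) : dist (E.z i) (E.z 0) + E.r i + 2 * δ * E.r 0 ≤ E.r 0 := by
  have hri := E.r_pos i
  have hr0 := E.r_pos 0
  obtain ⟨e, he, hv⟩ := exists_unit_direction (E.z i - E.z 0)
  rw [← dist_eq_norm] at hv
  set D := dist (E.z i) (E.z 0) with hD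
  have hp : dist (E.z i + E.r i • e) (E.z i) = E.r i := by
    rw [dist_self_add_left, norm_smul, he, mul_one, Real.norm_of_nonneg hri.le]
  have hq : dist (E.z 0 + E.r 0 • e) (E.z 0) = E.r 0 := by
    rw [dist_self_add_left, norm_smul, he, mul_one, Real.norm_of_nonneg hr0.le]
  have hin : dist (E.z i + E.r i • e) (E.z 0) ≤ E.r 0 := by
    have h1 := closure_mono (E.hole_subset i hi)
    rw [closure_ball _ hri.ne', closure_ball _ hr0.ne'] at h1
    exact h1 (Metric.mem_closedBall.2 hp.le)
  have e1 : E.z i + E.r i • e - E.z 0 = (D + E.r i) • e := by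
    rw [add_sub_right_comm, hv, add_smul]
  have e2 : E.z i + E.r i • e - (E.z 0 + E.r 0 • e) = (D + E.r i - E.r 0) • e := by
    rw [← sub_sub, e1, sub_smul]
  have hD0 : 0 ≤ D := dist_nonneg
  rw [dist_eq_norm, e1, norm_smul, he, mul_one, Real.norm_of_nonneg (by positivity)] at hin
  have h := le_dist_of_mem_family hδ hE hi hp hq
  rw [dist_eq_norm, e2, norm_smul, he, mul_one, Real.norm_of_nonpos (by linarith)] at h
  linarith

/-- The domains of the class have uniform collars, even after being shrunk a little. -/
theorem isCollared_of_mem_family (hδ : 0 < δ) (hE : E ∈ family δ) {ε : ℝ}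
    (hε : 0 ≤ ε) (hε' : ε ≤ δ * E.r 0 / 2) :
    IsCollared (E.z 0) (E.r 0 - ε) (fun i : E.Hole => E.z i) (fun i => E.r i + ε)
      -- With `w = δ * r₀ / 2` and `ε ≤ w`, two neighbouring holes lose `2 * ε + 2 * w ≤ 2 * δ *
      -- r₀`, exactly the gap available.
      (δ * E.r 0 / 2) where
  pos := by have := E.r_pos 0; positivity
  le_radius i := by
    have := le_radius_of_mem_family hδ hE i.2
    have : 0 < δ * E.r 0 := mul_pos hδ (E.r_pos 0)
    linarith
  inside i := by
    have := dist_add_le_of_mem_family hδ hE i.2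
    linarith
  apart i j hij := by
    have := add_le_dist_of_mem_family hδ hE i.2 j.2 (fun h => hij (Subtype.ext h))
    linarith

end PerforatedDisk

/-! ### From C¹ on shrunk domains to H¹ -/

section Shrink

open Filter Topology

variable {ι : Type} {z₀ : Plane} {r₀ : ℝ} {z : ι → Plane} {r : ι → ℝ}

theorem closedBall_subset_perforated {ε : ℝ} {x : Plane}
    (hx : x ∈ perforated z₀ (r₀ - ε) z fun i => r i + ε) :
    Metric.closedBall x ε ⊆ perforated z₀ r₀ z r := by
  intro y hy
  obtain ⟨h1, h2⟩ := hx
  simp only [Set.mem_iUnion, Metric.mem_closedBall, not_exists, not_le] at h2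
  rw [Metric.mem_ball] at h1
  rw [Metric.mem_closedBall] at hy
  refine ⟨?_, ?_⟩
  · rw [Metric.mem_ball]
    linarith [dist_triangle y x z₀]
  · simp only [Set.mem_iUnion, Metric.mem_closedBall, not_exists, not_le]
    intro i
    linarith [h2 i, dist_triangle_left x (z i) y]

theorem eventually_mem_perforated [Finite ι] {ε : ℕ → ℝ} (hε : Tendsto ε atTop (𝓝 0)) {x : Plane}
    (hx : x ∈ perforated z₀ r₀ z r) :
    ∀ᶠ n in atTop, x ∈ perforated z₀ (r₀ - ε n) z fun i => r i + ε n := by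
  obtain ⟨h1, h2⟩ := hx
  simp only [Set.mem_iUnion, Metric.mem_closedBall, not_exists, not_le] at h2
  rw [Metric.mem_ball] at h1
  have e1 : ∀ᶠ n in atTop, ε n < r₀ - dist x z₀ := hε.eventually_lt_const (by linarith)
  have e2 : ∀ᶠ n in atTop, ∀ i, ε n < dist x (z i) - r i :=
    eventually_all.2 fun i => hε.eventually_lt_const (by linarith [h2 i])
  filter_upwards [e1, e2] with n hn1 hn2
  refine ⟨?_, ?_⟩
  · rw [Metric.mem_ball]
    linarith
  · simp only [Set.mem_iUnion, Metric.mem_closedBall, not_exists, not_le]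
    intro i
    linarith [hn2 i]

/-- **Poincaré inequality for perforated disks** in `H¹`, from the one for functions of class `C¹`
on slightly smaller domains. -/
theorem exists_poincare_of_memSobolevH1 [Finite ι] {φ : Plane → ℝ} {g : Plane → Plane}
    (h : MemSobolevH1 (perforated z₀ r₀ z r) φ g) {K : ℝ≥0∞} {ε₀ : ℝ} (hε₀ : 0 < ε₀)
    (hK : ∀ ε, 0 < ε → ε ≤ ε₀ → ∀ f : Plane → ℝ, ContDiff ℝ 1 f → ∃ c : ℝ,
      ∫⁻ x in perforated z₀ (r₀ - ε) z (fun i => r i + ε), ‖f x - c‖ₑ ^ 2 ≤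
        K * ∫⁻ x in perforated z₀ (r₀ - ε) z (fun i => r i + ε), ‖fderiv ℝ f x‖ₑ ^ 2) :
    ∃ c : ℝ, ∫⁻ x in perforated z₀ r₀ z r, ‖φ x - c‖ₑ ^ 2 ≤
      4 * (K * ∫⁻ x in perforated z₀ r₀ z r, ‖g x‖ₑ ^ 2) := by
  have hU := measurableSet_perforated z₀ r₀ z r
  have hφ := locallyIntegrable_indicator_of_memLp hU h.1
  set ε : ℕ → ℝ := fun n => ε₀ * (1 / ((n : ℝ) + 1)) with hεdef
  have hεpos : ∀ n, 0 < ε n := fun n => by positivity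
  have hεle : ∀ n, ε n ≤ ε₀ := fun n => mul_le_of_le_one_right hε₀.le <| by
    rw [div_le_one (by positivity)]
    linarith [(Nat.cast_nonneg n : (0 : ℝ) ≤ n)]
  have hε : Tendsto ε atTop (𝓝 0) := by
    simpa only [mul_zero] using tendsto_one_div_add_atTop_nhds_zero_nat.const_mul ε₀
  let k : ℕ → ContDiffBump (0 : Plane) := fun n =>
    { rIn := ε n / 2
      rOut := ε n
      rIn_pos := half_pos (hεpos n)
      rIn_lt_rOut := half_lt_self (hεpos n) }
  have hlim : ∀ᵐ x : Plane, Tendsto (fun n => mollify (perforated z₀ r₀ z r) φ (k n) x) atTop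
      (𝓝 ((perforated z₀ r₀ z r).indicator φ x)) :=
    -- Almost everywhere convergence needs the ratio `rOut / rIn` bounded along the sequence; here
    -- it is `2`.
    ContDiffBump.ae_convolution_tendsto_right_of_locallyIntegrable (K := 2) hε
      (.of_forall fun n => by change ε n ≤ 2 * (ε n / 2); linarith) hφ
  refine exists_setLIntegral_le_of_tendsto
    (volume_perforated_lt_top z₀ r₀ z r).ne
    (E := fun n => perforated z₀ (r₀ - ε n) z fun i => r i + ε n)
    (fun n => measurableSet_perforated _ _ _ _)
    (fun n x hx => closedBall_subset_perforated hx (Metric.mem_closedBall_self (hεpos n).le))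
    (fun x hx => eventually_mem_perforated hε hx) hU
    (fun n => (contDiff_mollify (k n) hφ).continuous.measurable) h.1.1 ?_ ?_
  · filter_upwards [ae_restrict_of_ae hlim, ae_restrict_mem hU] with x hx hxU
    rwa [Set.indicator_of_mem hxU] at hx
  · intro n
    obtain ⟨c, hc⟩ := hK (ε n) (hεpos n) (hεle n) _ (contDiff_mollify (k n) hφ)
    refine ⟨c, hc.trans (mul_le_mul_right ?_ K)⟩
    exact lintegral_fderiv_mollify_le (k n) hU h
      (measurableSet_perforated z₀ (r₀ - ε n) z fun i => r i + ε n)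
      fun x hx => closedBall_subset_perforated hx

end Shrink

end

theorem mainTheorem4 :
    ∀ δ : ℝ, 0 < δ → δ < 1 →
      ∃ C : ℝ, 0 < C ∧ ∀ E ∈ PerforatedDisk.family δ,
        poincareConstant E.domain ≤ ENNReal.ofReal (C * E.r 0) := by
  intro δ hδ hδ1
  obtain ⟨C, hC0, hC⟩ := exists_poincare_perforated (half_pos hδ)
  -- The squared norm is at most `4 * C * r₀ ^ 2`, the `4` coming from the limit passage.
  refine ⟨2 * Real.sqrt C, by positivity, fun E hE => sSup_le ?_⟩
  rintro m ⟨φ, g, h, hg1, h0, rfl⟩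
  have hr0 := E.r_pos 0
  have hw : 0 < δ * E.r 0 / 2 := by positivity
  rw [PerforatedDisk.domain_eq_perforated] at *
  obtain ⟨c, hc⟩ := exists_poincare_of_memSobolevH1 h (K := ENNReal.ofReal (C * E.r 0 ^ 2)) hw (by
    intro ε hε hε' f hf
    -- This uses `δ < 1`: the shrunk outer radius stays positive.
    have hlt : ε < E.r 0 := by nlinarith
    obtain ⟨c, hc⟩ := hC E.Hole (E.z 0) (E.r 0 - ε) (fun i => E.z i) (fun i => E.r i + ε)
      (δ * E.r 0 / 2) (by linarith) (by nlinarith)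
      (PerforatedDisk.isCollared_of_mem_family hδ hE hε.le hε') f hf
    refine ⟨c, hc.trans ?_⟩
    have : 0 ≤ E.r 0 - ε := by linarith
    gcongr
    linarith)
  have hfin : IsFiniteMeasure ((volume : Measure Plane).restrict (perforated (E.z 0) (E.r 0)
      (fun i : E.Hole => E.z i) (fun i => E.r i))) :=
    ⟨by simpa using volume_perforated_lt_top _ _ _ _⟩
  have h1 := (lintegral_sq_le_of_integral_eq_zero h.1 h0 c).trans hc
  rw [lintegral_enorm_sq_eq, lintegral_enorm_sq_eq, hg1, one_pow, mul_one] at h1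
  rw [← ENNReal.pow_le_pow_left_iff two_ne_zero, ← ENNReal.ofReal_pow (by positivity)]
  refine h1.trans_eq ?_
  rw [← ENNReal.ofReal_ofNat, ← ENNReal.ofReal_mul (by norm_num), mul_pow, mul_pow,
    Real.sq_sqrt hC0.le]
  congr 1
  ring
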